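/- Let $\mathsf A$ be a finite alphabet with $|\mathsf A|\ge 2$ and let $(X_k)_{k\ge1}$ be the coordinate process on $\mathsf A^{\mathbb N}$; write $\mathbf P(x_{1:n})=\mathbf P(X_1=x_1,\dots,X_n=x_n)$. For $r\ge0$ let $\Theta^r$ be the set of laws $\mathbf P$ on $\mathsf A^{\mathbb N}$ of time-homogeneous Markov chains of order at most $r$: for some transition probabilities $q(\cdot\mid b)$, $b\in\mathsf A^r$, $$\mathbf P(x_{1:n})=\mathbf P(x_{1:r})\prod_{i=r+1}^n q(x_i\mid x_{i-r:i-1})\qquad\text{for all } n\ge r,\ x_{1:n}\in\mathsf A^n .$$ The order of $\mathbf P$ is the smallest $r$ with $\mathbf P\in\Theta^r$. Given a penalty $\mathrm{pen}(n,r)\in\mathbb R$ and a cutoff $\kappa(n)\in\mathbb R$, the penalized likelihood order estimator is $$\hat r_n=\hat r_n(x_{1:n})\in\operatorname*{argmax}_{0\le r<\kappa(n)}\Big\{\sup_{\mathbf P\in\Theta^r}\log\mathbf P(x_{1:n})-\mathrm{pen}(n,r)\Big\},$$ with ties broken arbitrarily (and with an arbitrary value when $\kappa(n)\le0$). There is an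 absolute constant $C^\star>0$, and for every finite alphabet $\mathsf A$ with $|\mathsf A|\ge2$ and every stationary Markov chain $\mathbf P^\star$ on $\mathsf A$ of order $r^\star<\infty$ that is irreducible (for any words $u,v\in\mathsf A^{r^\star}$ of positive probability there is $m\ge0$ with $\mathbf P^\star(X_{1:r^\star}=u,\,X_{m+1:m+r^\star}=v)>0$) there is a constant $\alpha^\star>0$, depending on $\mathbf P^\star$, with the following property. Let $\mathrm{pen}$, $\kappa$ and $f:\mathbb N\to\mathbb R$ be such that for all sufficiently large $n$ $$\mathrm{pen}(n,r)=|\mathsf A|^r f(n)\log\log n\quad(r\ge0),\qquad \kappa(n)\le\alpha^\star\log n,$$ where $\kappa$ is nondecreasing with $\kappa(n)\to\infty$, and $$\liminf_{n\to\infty}f(n)\ge C^\star,\qquad \lim_{n\to\infty}\frac{f(n)\log\log n}{n}=0 .$$ Then the estimator is strongly consistent: $\hat r_n(X_{1:n})\to r^\star$ as $n\to\infty$, $\mathbf P^\star$-almost surely. -/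

import Mathlib

open MeasureTheory Filter Topology

noncomputable section

namespace MarkovOrder

variable {A : Type*}

/-- The word `x_{m+1:m+n}` of a sequence `x`; the coordinate `X_k` (`k ≥ 1`) of the canonical space
is `ω ↦ ω (k - 1)`, so the index set `{1, 2, …}` is shifted to `{0, 1, …}`. -/
def block (x : ℕ → A) (m n : ℕ) : Fin n → A := fun i => x (m + i)

/-- `P(x_{1:n})`, the probability that the first `n` letters form the word `x`. -/
def wordProb [MeasurableSpace A] (P : Measure (ℕ → A)) {n : ℕ} (x : Fin n → A) : ENNReal :=
  P {ω | block ω 0 n = x}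

/-- The set `Θ^r` of laws of time homogeneous Markov chains of order at most `r`, with arbitrary
initial law on `A^r`: for some transition probabilities `q(· | b)`, `b ∈ A^r`,
`P(x_{1:n}) = P(x_{1:r}) ∏_{i=r+1}^{n} q(x_i | x_{i-r:i-1})` for all `n = r + m ≥ r`.
(Then `P(X_i = a | X_{i-r:i-1} = b) = q(a | b)` for all `i > r` for which the conditioning
event has positive probability; the other values of `q` are irrelevant.) -/
def markovLaws (A : Type*) [MeasurableSpace A] (r : ℕ) : Set (Measure (ℕ → A)) :=
  {P | IsProbabilityMeasure P ∧ ∃ q : (Fin r → A) → PMF A, ∀ (m : ℕ) (x : ℕ → A),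
    wordProb P (block x 0 (r + m)) =
      wordProb P (block x 0 r) * ∏ j ∈ Finset.range m, q (block x j r) (x (j + r))}

/-- `P` is the law of a Markov chain of order exactly `r`. -/
def HasOrder [MeasurableSpace A] (P : Measure (ℕ → A)) (r : ℕ) : Prop :=
  IsLeast {k | P ∈ markovLaws A k} r

/-- Stationarity: the law is invariant under the left shift. -/
def IsStationary [MeasurableSpace A] (P : Measure (ℕ → A)) : Prop :=
  MeasurePreserving (fun (ω : ℕ → A) (k : ℕ) => ω (k + 1)) P P

/-- Irreducibility of a (stationary) chain of order `r`: any two words of length `r` of positive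
probability (the states of the chain of `r`-blocks) communicate. -/
def IsIrreducible [MeasurableSpace A] (P : Measure (ℕ → A)) (r : ℕ) : Prop :=
  ∀ u v : Fin r → A, 0 < wordProb P u → 0 < wordProb P v →
    ∃ m : ℕ, 0 < P {ω | block ω 0 r = u ∧ block ω m r = v}

/-- The maximal log-likelihood `sup_{P ∈ Θ^r} log P(x_{1:n})`, where `log 0 = -∞`. -/
def maxLogLik [MeasurableSpace A] (r : ℕ) {n : ℕ} (x : Fin n → A) : EReal :=
  ⨆ P ∈ markovLaws A r, ENNReal.log (wordProb P x)

/-- `rhat` is a penalized likelihood order estimator with penalty `pen` and cutoff `κ`: at every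
`x_{1:n}` it picks a maximizer of the penalized likelihood over `0 ≤ r < κ(n)`, with ties broken
arbitrarily (and any value if there is no such `r`, i.e. if `κ(n) ≤ 0`). -/
def IsPenalizedLikelihoodEstimator [MeasurableSpace A] (pen : ℕ → ℕ → ℝ) (κ : ℕ → ℝ)
    (rhat : (n : ℕ) → (Fin n → A) → ℕ) : Prop :=
  ∀ (n : ℕ) (x : Fin n → A), 0 < κ n →
    (rhat n x : ℝ) < κ n ∧
      IsMaxOn (fun r : ℕ => maxLogLik r x - (pen n r : EReal)) {r : ℕ | (r : ℝ) < κ n} (rhat n x)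

/-- Almost sure convergence of the estimator, under `P`, to `r`. -/
def IsStronglyConsistent [MeasurableSpace A] (P : Measure (ℕ → A)) (r : ℕ)
    (rhat : (n : ℕ) → (Fin n → A) → ℕ) : Prop :=
  ∀ᵐ ω ∂P, Tendsto (fun n : ℕ => rhat n (block ω 0 n)) atTop (𝓝 r)

end MarkovOrder

end

/-! Two errors have to be excluded almost surely for all large `n`.

Overestimation. For each order `k ≥ r`, the likelihood ratio against the true law is controlled by a
nonnegative supermartingale: a product over contexts of mixtures of Pólya urns whose initial
composition is proportional to the true transition law. An urn of fixed mass would lose a multiple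
of `log n` per context. An urn whose mass is comparable to the number of visits loses only a
constant, at the price of dividing the maximal log-likelihood ratio by 8
(`maxLogRatio_le_log_polyaRatio`). Masses `2 ^ j` with weights `1 / ((j + 1) (j + 2))` cover all
visit counts, and the weight costs about `2 log log n`. Ville's inequality with thresholds `K 2 ^ k`
controls all times and all orders at once. This gives an excess log-likelihood of at most `16 |A| ^
k log log n + O(|A| ^ k)` with a random constant uniform in `k` and `n`
(`IsTransition.ae_exists_wordProb_le`). The penalty increment from `r` to `k > r` is at least half
of `|A| ^ k f(n) log log n`, so `f ≥ 50` suffices.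

Underestimation. If `k < r`, stationarity and irreducibility force every kernel of order `k` to
differ from the true one at a state that is reached in boundedly many steps, so Hellinger affinities
over a fixed horizon are below 1. By compactness finitely many upper brackets cover all kernels of
order `k`, and the square root of each bracket's likelihood ratio decays exponentially. The
likelihood loss is linear in `n` (`IsTransition.ae_wordProb_le_exp`) and beats the penalty, which is
`o(n)`. -/

noncomputable section

namespace MarkovOrder

section Words

variable {A : Type*}

/-! ### Words and functions of finitely many letters -/

/-- The sequence that starts with the word `x` and is constantly `a` afterwards. -/
def extend {n : ℕ} (x : Fin n → A) (a : A) : ℕ → A := fun i => if h : i < n then x ⟨i, h⟩ else a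

theorem block_extend {n : ℕ} (x : Fin n → A) (a : A) : block (extend x a) 0 n = x := by
  funext i
  simp [block, extend]

theorem extend_self {n : ℕ} (x : Fin n → A) (a : A) : extend x a n = a := by
  simp [extend]

theorem block_congr {x y : ℕ → A} {m n : ℕ} (h : ∀ i < m + n, x i = y i) :
    block x m n = block y m n := by
  funext i
  exact h _ (by omega)

theorem block_update {x : ℕ → A} {m n k : ℕ} (h : m + n ≤ k) (a : A) :
    block (Function.update x k a) m n = block x m n :=
  block_congr fun i hi => Function.update_of_ne (by omega) _ _

theorem block_zero_eq_iff {x y : ℕ → A} {n : ℕ} :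
    block x 0 n = block y 0 n ↔ ∀ i < n, x i = y i := by
  refine ⟨fun h i hi => ?_, fun h => block_congr fun i hi => h i (by omega)⟩
  simpa [block] using congrFun h ⟨i, hi⟩

theorem block_zero_succ_eq_iff {x y : ℕ → A} {n : ℕ} :
    block x 0 (n + 1) = block y 0 (n + 1) ↔ block x 0 n = block y 0 n ∧ x n = y n := by
  simp only [block_zero_eq_iff, Nat.lt_succ_iff_lt_or_eq, or_imp, forall_and, forall_eq]

theorem dependsOn_iff_exists_block [Nonempty A] {β : Type*} {n : ℕ} {F : (ℕ → A) → β} :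
    DependsOn F (Set.Iio n) ↔ ∃ f : (Fin n → A) → β, ∀ ω, F ω = f (block ω 0 n) := by
  constructor
  · intro hF
    refine ⟨fun x => F (extend x (Classical.arbitrary A)), fun ω => hF fun i hi => ?_⟩
    rw [Set.mem_Iio] at hi
    simp [extend, hi, block]
  · rintro ⟨f, hf⟩ x y h
    rw [hf, hf, block_zero_eq_iff.2 h]

variable [MeasurableSpace A]

theorem measurable_block (m n : ℕ) : Measurable fun ω : ℕ → A => block ω m n :=
  measurable_pi_lambda _ fun _ => measurable_pi_apply _

theorem measurable_of_dependsOn [Finite A] [Nonempty A] [MeasurableSingletonClass A] {β : Type*}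
    [MeasurableSpace β] {n : ℕ} {F : (ℕ → A) → β} (hF : DependsOn F (Set.Iio n)) :
    Measurable F := by
  obtain ⟨f, hf⟩ := dependsOn_iff_exists_block.1 hF
  rw [show F = f ∘ fun ω => block ω 0 n from funext hf]
  exact (measurable_of_countable f).comp (measurable_block _ _)

theorem lintegral_comp_block [Fintype A] [MeasurableSingletonClass A] (P : Measure (ℕ → A))
    {n : ℕ} (f : (Fin n → A) → ENNReal) :
    ∫⁻ ω, f (block ω 0 n) ∂P = ∑ x, f x * wordProb P x := by
  classical
  rw [← lintegral_map (μ := P) (measurable_of_countable f) (measurable_block 0 n),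
    lintegral_fintype]
  refine Finset.sum_congr rfl fun x _ => ?_
  rw [Measure.map_apply (measurable_block 0 n) (measurableSet_singleton x)]
  rfl

theorem ae_wordProb_pos [Finite A] [MeasurableSingletonClass A] (P : Measure (ℕ → A)) :
    ∀ᵐ ω ∂P, ∀ n, 0 < wordProb P (block ω 0 n) := by
  refine ae_all_iff.2 fun n => ?_
  have h : ∀ᵐ ω ∂P, ∀ x : Fin n → A, wordProb P x = 0 → block ω 0 n ≠ x := by
    refine ae_all_iff.2 fun x => ?_
    by_cases hx : wordProb P x = 0
    · have : ∀ᵐ ω ∂P, block ω 0 n ≠ x := by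
        rw [ae_iff]
        simpa [wordProb] using hx
      filter_upwards [this] with ω hω _ using hω
    · exact Eventually.of_forall fun ω h => absurd h hx
  filter_upwards [h] with ω hω
  exact pos_iff_ne_zero.2 fun h0 => hω _ h0 rfl

theorem wordProb_le_one (P : Measure (ℕ → A)) [IsProbabilityMeasure P] {n : ℕ} (x : Fin n → A) :
    wordProb P x ≤ 1 := prob_le_one

/-! ### Transition probabilities -/

/-- `q` is a family of transition probabilities of order `r` for `P`. -/
def IsTransition (P : Measure (ℕ → A)) (r : ℕ) (q : (Fin r → A) → PMF A) : Prop :=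
  ∀ (m : ℕ) (x : ℕ → A),
    wordProb P (block x 0 (r + m)) =
      wordProb P (block x 0 r) * ∏ j ∈ Finset.range m, q (block x j r) (x (j + r))

variable {P : Measure (ℕ → A)} {r : ℕ} {q : (Fin r → A) → PMF A}

theorem IsTransition.wordProb_succ (hq : IsTransition P r q) (m : ℕ) (x : ℕ → A) :
    wordProb P (block x 0 (m + r + 1)) =
      wordProb P (block x 0 (m + r)) * q (block x m r) (x (m + r)) := by
  have h := hq (m + 1) x
  rw [Finset.prod_range_succ, ← mul_assoc, ← hq m x] at h
  rw [show m + r + 1 = r + (m + 1) by omega, h, show m + r = r + m by omega]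

theorem IsTransition.pos_of_wordProb_pos (hq : IsTransition P r q) {x : ℕ → A}
    (hx : ∀ n, 0 < wordProb P (block x 0 n)) (m : ℕ) : 0 < q (block x m r) (x (m + r)) := by
  have h := hx (m + r + 1)
  rw [hq.wordProb_succ] at h
  exact pos_iff_ne_zero.2 (right_ne_zero_of_mul h.ne')

theorem IsTransition.measure_block_inter (hq : IsTransition P r q) (m : ℕ) (x : ℕ → A) :
    P {ω | block ω 0 (m + r) = block x 0 (m + r) ∧ ω (m + r) = x (m + r)} =
      wordProb P (block x 0 (m + r)) * q (block x m r) (x (m + r)) := by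
  rw [← hq.wordProb_succ]
  simp only [wordProb, block_zero_succ_eq_iff]

/-- Integrating out the last letter: the one-step Markov property. -/
theorem IsTransition.lintegral_eq [Fintype A] [Nonempty A] [MeasurableSingletonClass A]
    (hq : IsTransition P r q) {m : ℕ} {F : (ℕ → A) → ENNReal}
    (hF : DependsOn F (Set.Iio (m + r + 1))) :
    ∫⁻ ω, F ω ∂P =
      ∫⁻ ω, ∑ a, q (block ω m r) a * F (Function.update ω (m + r) a) ∂P := by
  classical
  have hmeas : Measurable F := measurable_of_dependsOn hF
  have hG : ∀ a, DependsOn (fun ω : ℕ → A => F (Function.update ω (m + r) a))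
      (Set.Iio (m + r)) := by
    intro a x y hxy
    refine hF fun i hi => ?_
    by_cases h : i = m + r
    · simp [h]
    · simp only [Set.mem_Iio] at hi hxy
      simp [h, hxy i (by omega)]
  have hlet : ∀ a : A, MeasurableSet {ω : ℕ → A | ω (m + r) = a} := fun a =>
    (measurableSet_singleton a).preimage (measurable_pi_apply (m + r))
  have hqm : ∀ a, Measurable fun ω : ℕ → A => q (block ω m r) a := fun a =>
    (measurable_of_countable fun b => q b a).comp (measurable_block m r)
  -- On the event that the last letter is `a`, `F` is a function of the earlier letters only, so the
  -- claim reduces to probabilities of words.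
  have hstep : ∀ a : A, ∫⁻ ω in {ω | ω (m + r) = a}, F ω ∂P =
      ∫⁻ ω, q (block ω m r) a * F (Function.update ω (m + r) a) ∂P := by
    intro a
    obtain ⟨g, hg⟩ := dependsOn_iff_exists_block.1 (hG a)
    have h1 : ∫⁻ ω in {ω | ω (m + r) = a}, F ω ∂P =
        ∫⁻ ω in {ω | ω (m + r) = a}, g (block ω 0 (m + r)) ∂P := by
      refine setLIntegral_congr_fun (hlet a) fun ω hω => ?_
      rw [← hg, ← show ω (m + r) = a from hω, Function.update_eq_self]
    have h2 : ∀ x : Fin (m + r) → A,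
        wordProb (P.restrict {ω | ω (m + r) = a}) x =
          q (block (extend x a) m r) a * wordProb P x := by
      intro x
      have h := hq.measure_block_inter m (extend x a)
      rw [block_extend, extend_self] at h
      rw [mul_comm, ← h, wordProb, Measure.restrict_apply]
      · rfl
      · exact measurable_block 0 (m + r) (measurableSet_singleton x)
    have h3 : ∀ ω : ℕ → A, q (block ω m r) a * F (Function.update ω (m + r) a) =
        (fun x => q (block (extend x a) m r) a * g x) (block ω 0 (m + r)) := by
      intro ω
      have : block (extend (block ω 0 (m + r)) a) m r = block ω m r :=
        block_congr fun i hi => by simp [extend, hi, block]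
      simp only [this, hg]
    rw [h1, lintegral_comp_block, lintegral_congr h3,
      lintegral_comp_block P fun x => q (block (extend x a) m r) a * g x]
    refine Finset.sum_congr rfl fun x _ => ?_
    rw [h2]
    ring
  have hsplit : ∫⁻ ω, F ω ∂P = ∑ a, ∫⁻ ω in {ω | ω (m + r) = a}, F ω ∂P := by
    have : ∀ ω, F ω = ∑ a, ({ω : ℕ → A | ω (m + r) = a}).indicator F ω := by
      intro ω
      simp [Set.indicator_apply]
    rw [lintegral_congr this, lintegral_finsetSum]
    · exact Finset.sum_congr rfl fun a _ => lintegral_indicator (hlet a) _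
    · exact fun a _ => hmeas.indicator (hlet a)
  rw [hsplit, lintegral_finsetSum]
  · exact Finset.sum_congr rfl fun a _ => hstep a
  · exact fun a _ => (hqm a).mul (measurable_of_dependsOn (hG a))

/-! ### The maximal inequality -/

/-- Ville's inequality, for nonnegative functions of the past with decreasing integrals over
the events of the past. -/
theorem mul_measure_exists_le_lintegral [Finite A] [Nonempty A] [MeasurableSingletonClass A]
    {Y : ℕ → (ℕ → A) → ENNReal} {k : ℕ} (hY : ∀ m, DependsOn (Y m) (Set.Iio (m + k)))
    (hdecr : ∀ (m : ℕ) (E : Set (ℕ → A)), DependsOn (· ∈ E) (Set.Iio (m + k)) →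
      ∫⁻ ω in E, Y (m + 1) ω ∂P ≤ ∫⁻ ω in E, Y m ω ∂P) (t : ENNReal) :
    t * P {ω | ∃ m, t ≤ Y m ω} ≤ ∫⁻ ω, Y 0 ω ∂P := by
  let B : ℕ → Set (ℕ → A) := fun n => {ω | ∀ m < n, Y m ω < t}
  have hBdep : ∀ n, DependsOn (· ∈ B (n + 1)) (Set.Iio (n + k)) := by
    intro n x y hxy
    simp only [B, Set.mem_ofPred_eq, eq_iff_iff]
    refine forall₂_congr fun m hm => ?_
    rw [hY m fun i hi => hxy i ?_]
    simp only [Set.mem_Iio] at hi ⊢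
    omega
  have hBmeas : ∀ n, MeasurableSet (B n) := by
    intro n
    have : B n = ⋂ m, ⋂ (_ : m < n), {ω | Y m ω < t} := by ext; simp [B]
    rw [this]
    exact MeasurableSet.iInter fun m => MeasurableSet.iInter fun _ =>
      measurable_of_dependsOn (hY m) measurableSet_Iio
  have hBanti : ∀ n, B (n + 1) ⊆ B n := fun n ω hω m hm => hω m (by omega)
  -- `B n` is the event that level `t` is not reached before time `n`. The left side bounds from
  -- below the integral of the process stopped at level `t`, with the value `t` counted once the
  -- level is reached.
  have key : ∀ n, t * P (B n)ᶜ + ∫⁻ ω in B n, Y n ω ∂P ≤ ∫⁻ ω, Y 0 ω ∂P := by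
    intro n
    induction n with
    | zero => simp [B]
    | succ n ih =>
      refine le_trans ?_ ih
      have h1 : (B (n + 1))ᶜ = (B n)ᶜ ∪ (B n \ B (n + 1)) := by
        ext ω
        have := @hBanti n ω
        simp only [Set.mem_compl_iff, Set.mem_union, Set.mem_sdiff]
        tauto
      have h2 : B n = B (n + 1) ∪ (B n \ B (n + 1)) := by
        rw [Set.union_sdiff_cancel (hBanti n)]
      have h3 : P (B (n + 1))ᶜ ≤ P (B n)ᶜ + P (B n \ B (n + 1)) := by
        rw [h1]; exact measure_union_le _ _
      have h4 : ∫⁻ ω in B n, Y n ω ∂P =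
          ∫⁻ ω in B (n + 1), Y n ω ∂P + ∫⁻ ω in B n \ B (n + 1), Y n ω ∂P := by
        conv_lhs => rw [h2]
        exact lintegral_union ((hBmeas n).diff (hBmeas (n + 1))) Set.disjoint_sdiff_right
      have h5 : t * P (B n \ B (n + 1)) ≤ ∫⁻ ω in B n \ B (n + 1), Y n ω ∂P := by
        rw [← setLIntegral_const]
        refine setLIntegral_mono (measurable_of_dependsOn (hY n)) fun ω hω => ?_
        by_contra! hlt
        refine hω.2 fun m hm => ?_
        rcases Nat.lt_succ_iff_lt_or_eq.1 hm with h | rfl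
        exacts [hω.1 m h, hlt]
      have h6 := hdecr n (B (n + 1)) (hBdep n)
      calc t * P (B (n + 1))ᶜ + ∫⁻ ω in B (n + 1), Y (n + 1) ω ∂P
          ≤ t * (P (B n)ᶜ + P (B n \ B (n + 1))) + ∫⁻ ω in B (n + 1), Y n ω ∂P := by gcongr
        _ = t * P (B n)ᶜ + (∫⁻ ω in B (n + 1), Y n ω ∂P + t * P (B n \ B (n + 1))) := by ring
        _ ≤ _ := by rw [h4]; gcongr
  have hunion : {ω | ∃ m, t ≤ Y m ω} = ⋃ n, (B n)ᶜ := by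
    ext ω
    simp only [Set.mem_ofPred_eq, Set.mem_iUnion, Set.mem_compl_iff, B, not_forall, not_lt]
    exact ⟨fun ⟨m, hm⟩ => ⟨m + 1, m, by omega, hm⟩, fun ⟨_, m, _, hm⟩ => ⟨m, hm⟩⟩
  have hmono : Monotone fun n => (B n)ᶜ :=
    monotone_nat_of_le_succ fun n => Set.compl_subset_compl.2 (hBanti n)
  rw [hunion, hmono.measure_iUnion, ENNReal.mul_iSup]
  exact iSup_le fun n => le_trans le_self_add (key n)

end Words

/-! ### Pólya urn likelihood ratios -/

section Polya

open InformationTheory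

/-- A left Riemann sum of the increasing function `log` lies below its integral, whose
antiderivative is `x log x - x`. The next lemma is the reverse bound, where the correction is the
total increase of `log`. -/
theorem sum_log_add_le {s : ℝ} (hs : 0 < s) (T : ℕ) :
    ∑ i ∈ Finset.range T, Real.log (s + i) ≤
      ((s + T) * Real.log (s + T) - (s + T)) - (s * Real.log s - s) := by
  induction T with
  | zero => simp
  | succ T ih =>
    rw [Finset.sum_range_succ]
    have hy : 0 < s + T := by positivity
    have hy1 : 0 < s + T + 1 := by positivity
    have h := Real.one_sub_inv_le_log_of_pos (div_pos hy1 hy)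
    rw [Real.log_div hy1.ne' hy.ne', inv_div] at h
    have h2 : (s + T + 1) * (1 - (s + T) / (s + T + 1)) = 1 := by field_simp; ring
    have h3 := mul_le_mul_of_nonneg_left h hy1.le
    push_cast
    rw [← add_assoc]
    nlinarith

theorem le_sum_log_add {s : ℝ} (hs : 0 < s) (T : ℕ) :
    ((s + T) * Real.log (s + T) - (s + T)) - (s * Real.log s - s) -
      (Real.log (s + T) - Real.log s) ≤ ∑ i ∈ Finset.range T, Real.log (s + i) := by
  induction T with
  | zero => simp
  | succ T ih =>
    rw [Finset.sum_range_succ]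
    have hy : 0 < s + T := by positivity
    have hy1 : 0 < s + T + 1 := by positivity
    have h := Real.log_le_sub_one_of_pos (div_pos hy1 hy)
    rw [Real.log_div hy1.ne' hy.ne'] at h
    have h2 : (s + T) * ((s + T + 1) / (s + T) - 1) = 1 := by field_simp; ring
    have h3 := mul_le_mul_of_nonneg_left h hy.le
    push_cast
    rw [← add_assoc]
    nlinarith

theorem klFun_le_sq {t : ℝ} (ht : 0 ≤ t) : klFun t ≤ (t - 1) ^ 2 := by
  rcases ht.eq_or_lt with rfl | ht
  · simp [klFun]
  · have := Real.log_le_sub_one_of_pos ht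
    rw [klFun]
    nlinarith

theorem sq_half_le_klFun {v : ℝ} (hv : -1 ≤ v) (hv' : v ≤ 0) : v ^ 2 / 2 ≤ klFun (1 + v) := by
  have hanti : AntitoneOn (fun v : ℝ => klFun (1 + v) - v ^ 2 / 2) (Set.Icc (-1) 0) := by
    have hd : ∀ x ∈ interior (Set.Icc (-1 : ℝ) 0),
        HasDerivAt (fun v : ℝ => klFun (1 + v) - v ^ 2 / 2) (Real.log (1 + x) - x) x := by
      intro x hx
      rw [interior_Icc] at hx
      have h1 : HasDerivAt (fun v : ℝ => klFun (1 + v)) (Real.log (1 + x)) x :=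
        (hasDerivAt_klFun (x := 1 + x) (by linarith [hx.1])).comp_const_add 1 x
      have h2 : HasDerivAt (fun v : ℝ => v ^ 2 / 2) x x := by
        have := (hasDerivAt_pow 2 x).div_const 2
        simpa using this
      exact h1.sub h2
    refine antitoneOn_of_deriv_nonpos (convex_Icc _ _) ?_ ?_ ?_
    · exact (Continuous.sub (continuous_klFun.comp (by fun_prop)) (by fun_prop)).continuousOn
    · exact fun x hx => (hd x hx).differentiableAt.differentiableWithinAt
    · intro x hx
      rw [(hd x hx).deriv]
      rw [interior_Icc] at hx
      have := Real.log_le_sub_one_of_pos (show 0 < 1 + x by linarith [hx.1])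
      linarith
  have := hanti ⟨hv, hv'⟩ ⟨by norm_num, le_rfl⟩ hv'
  simp only [add_zero, klFun_one] at this
  linarith

theorem klFun_le_mul_klFun_of_nonneg {β u : ℝ} (hβ : 1 / 2 ≤ β) (hu : 0 ≤ u) :
    klFun (1 + u) ≤ 8 * klFun (1 + β * u) := by
  have hmono : MonotoneOn (fun u : ℝ => 8 * klFun (1 + β * u) - klFun (1 + u)) (Set.Ici 0) := by
    have hd : ∀ x ∈ interior (Set.Ici (0 : ℝ)),
        HasDerivAt (fun u : ℝ => 8 * klFun (1 + β * u) - klFun (1 + u))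
          (8 * (Real.log (1 + β * x) * β) - Real.log (1 + x)) x := by
      intro x hx
      rw [interior_Ici, Set.mem_Ioi] at hx
      have h1 : HasDerivAt (fun v : ℝ => klFun (1 + v)) (Real.log (1 + x)) x :=
        (hasDerivAt_klFun (x := 1 + x) (by linarith)).comp_const_add 1 x
      have h2 : HasDerivAt (fun v : ℝ => 1 + β * v) β x := by
        simpa using ((hasDerivAt_id x).const_mul β).const_add 1
      have h3 := (hasDerivAt_klFun (x := 1 + β * x) (by positivity)).comp x h2
      exact (h3.const_mul 8).sub h1
    refine monotoneOn_of_deriv_nonneg (convex_Ici _) ?_ ?_ ?_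
    · exact (Continuous.sub (continuous_const.mul (continuous_klFun.comp (by fun_prop)))
        (continuous_klFun.comp (by fun_prop))).continuousOn
    · exact fun x hx => (hd x hx).differentiableAt.differentiableWithinAt
    · intro x hx
      rw [(hd x hx).deriv]
      rw [interior_Ici, Set.mem_Ioi] at hx
      have h1 : Real.log (1 + x) ≤ 2 * Real.log (1 + β * x) := by
        rw [← Real.log_rpow (by positivity)]
        refine Real.log_le_log (by positivity) ?_
        rw [Real.rpow_two]
        nlinarith [sq_nonneg (β * x)]
      have h2 : 0 ≤ Real.log (1 + β * x) := Real.log_nonneg (by nlinarith)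
      nlinarith
  have := hmono (Set.self_mem_Ici) hu hu
  simp only [mul_zero, add_zero, klFun_one, sub_zero] at this
  linarith

/-- Shrinking a deviation by a factor of at least 1/2 costs a bounded factor in relative entropy.
For `u ≤ 0`, the chain `klFun (1 + u) ≤ u² ≤ 4 (β u)² ≤ 8 klFun (1 + β u)` produces the constant 8.
For `u ≥ 0`, derivatives are compared using `1 + u ≤ (1 + β u)²`. -/
theorem klFun_le_mul_klFun {β u : ℝ} (hβ : 1 / 2 ≤ β) (hβ' : β ≤ 1) (hu : -1 ≤ u) :
    klFun (1 + u) ≤ 8 * klFun (1 + β * u) := by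
  rcases le_total 0 u with h | h
  · exact klFun_le_mul_klFun_of_nonneg hβ h
  · have h1 := klFun_le_sq (t := 1 + u) (by linarith)
    have h2 := sq_half_le_klFun (v := β * u) (by nlinarith) (by nlinarith)
    have h3 : (1 / 2) ^ 2 * u ^ 2 ≤ (β * u) ^ 2 := by
      rw [mul_pow]
      gcongr
    nlinarith

variable {A : Type*} [Fintype A]

/-- The likelihood ratio, with respect to the law `p`, of a sample with letter counts `N` under
the Pólya urn scheme with initial composition `s * p`. -/
def polyaRatio (p : A → ℝ) (s : ℝ) (N : A → ℕ) : ℝ :=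
  (∏ a, ∏ i ∈ Finset.range (N a), ((s * p a + i) / p a)) /
    ∏ i ∈ Finset.range (∑ a, N a), (s + i)

theorem polyaRatio_nonneg {p : A → ℝ} (hp : ∀ a, 0 ≤ p a) {s : ℝ} (hs : 0 < s) (N : A → ℕ) :
    0 ≤ polyaRatio p s N :=
  div_nonneg (Finset.prod_nonneg fun a _ => Finset.prod_nonneg fun i _ =>
      div_nonneg (by have := hp a; positivity) (hp a))
    (Finset.prod_nonneg fun i _ => by positivity)

theorem polyaRatio_zero (p : A → ℝ) (s : ℝ) : polyaRatio p s 0 = 1 := by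
  simp [polyaRatio]

theorem polyaRatio_update [DecidableEq A] (p : A → ℝ) (s : ℝ) (N : A → ℕ) (a : A) :
    polyaRatio p s (N + Pi.single a 1) =
      polyaRatio p s N * ((s * p a + N a) / p a / (s + ∑ c, N c)) := by
  have h1 : ∑ c, (N + Pi.single a 1 : A → ℕ) c = ∑ c, N c + 1 := by
    simp [Finset.sum_add_distrib]
  have h2 : ∏ c, ∏ i ∈ Finset.range ((N + Pi.single a 1 : A → ℕ) c), ((s * p c + i) / p c) =
      (∏ c, ∏ i ∈ Finset.range (N c), ((s * p c + i) / p c)) * ((s * p a + N a) / p a) := by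
    rw [← Finset.mul_prod_erase _ _ (Finset.mem_univ a),
      ← Finset.mul_prod_erase (a := a) _ (fun c => ∏ i ∈ Finset.range (N c), _) (Finset.mem_univ a)]
    have h3 : ∀ c ∈ Finset.univ.erase a,
        ∏ i ∈ Finset.range ((N + Pi.single a 1 : A → ℕ) c), ((s * p c + i) / p c) =
          ∏ i ∈ Finset.range (N c), ((s * p c + i) / p c) := by
      intro c hc
      rw [Pi.add_apply, Pi.single_eq_of_ne (Finset.ne_of_mem_erase hc), add_zero]
    rw [Finset.prod_congr rfl h3, Pi.add_apply, Pi.single_eq_same, Finset.prod_range_succ]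
    ring
  rw [polyaRatio, polyaRatio, h1, h2, Finset.prod_range_succ]
  push_cast
  rw [div_mul_div_comm]

/-- The supermartingale property of the urn ratio: the urn's predictive probabilities sum to 1.
Equality may fail because letters with `p a = 0` drop out on the left but may carry urn mass on the
right. -/
theorem sum_mul_polyaRatio_update_le [DecidableEq A] {p : A → ℝ} (hp : ∀ a, 0 ≤ p a)
    (hp1 : ∑ a, p a = 1) {s : ℝ} (hs : 0 < s) (N : A → ℕ) :
    ∑ a, p a * polyaRatio p s (N + Pi.single a 1) ≤ polyaRatio p s N := by
  have hT : 0 < s + ∑ c, (N c : ℝ) := by positivity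
  have h : ∀ a, p a * polyaRatio p s (N + Pi.single a 1) ≤
      polyaRatio p s N * ((s * p a + N a) / (s + ∑ c, (N c : ℝ))) := by
    intro a
    rw [polyaRatio_update]
    push_cast
    have h0 := polyaRatio_nonneg hp hs N
    rcases (hp a).eq_or_lt with ha | ha
    · rw [← ha]
      simp only [zero_mul, mul_zero, zero_add]
      positivity
    · refine le_of_eq ?_
      field_simp
  refine (Finset.sum_le_sum fun a _ => h a).trans_eq ?_
  rw [← Finset.mul_sum, ← Finset.sum_div, Finset.sum_add_distrib, ← Finset.mul_sum, hp1, mul_one,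
    div_self hT.ne', mul_one]

/-- The logarithm of the maximal likelihood ratio, with respect to the law `p`, of a sample with
letter counts `N`. -/
def maxLogRatio (p : A → ℝ) (N : A → ℕ) : ℝ :=
  ∑ a, N a * Real.log (N a / ((∑ c, (N c : ℝ)) * p a))

/-- Gibbs' inequality, from `log x ≤ x - 1`: empirical frequencies maximize the likelihood. -/
theorem sum_mul_log_div_le_maxLogRatio {p q : A → ℝ} {N : A → ℕ} (hq : ∀ a, 0 ≤ q a)
    (hq1 : ∑ a, q a = 1) (hpN : ∀ a, N a ≠ 0 → 0 < p a) (hqN : ∀ a, N a ≠ 0 → 0 < q a) :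
    ∑ a, N a * Real.log (q a / p a) ≤ maxLogRatio p N := by
  set T : ℝ := ∑ c, (N c : ℝ) with hT
  have h : ∀ a, N a * Real.log (q a / p a) - N a * Real.log (N a / (T * p a)) ≤
      T * q a - N a := by
    intro a
    have hT0 : 0 ≤ T := by positivity
    by_cases ha : N a = 0
    · simp only [ha, Nat.cast_zero, zero_mul, sub_zero]
      exact mul_nonneg hT0 (hq a)
    · have hNa : (0 : ℝ) < N a := by positivity
      have hTpos : 0 < T := hNa.trans_le
        (Finset.single_le_sum (f := fun c => (N c : ℝ)) (fun c _ => by positivity)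
          (Finset.mem_univ a))
      have hpa := hpN a ha
      have hqa := hqN a ha
      have h1 := Real.log_le_sub_one_of_pos (show 0 < T * q a / N a by positivity)
      have h2 : Real.log (q a / p a) - Real.log (N a / (T * p a)) = Real.log (T * q a / N a) := by
        rw [← Real.log_div (by positivity) (by positivity)]
        congr 1
        field_simp
      rw [← mul_sub, h2]
      calc N a * Real.log (T * q a / N a) ≤ N a * (T * q a / N a - 1) := by gcongr
        _ = T * q a - N a := by field_simp
  have hs := Finset.sum_le_sum fun a (_ : a ∈ Finset.univ) => h a
  rw [Finset.sum_sub_distrib, Finset.sum_sub_distrib, ← Finset.mul_sum, hq1, mul_one, ← hT,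
    sub_self] at hs
  rw [maxLogRatio, ← hT]
  linarith

/-- The Pólya urn with initial mass comparable to the sample size attains, up to constants, the
maximal likelihood. -/
theorem maxLogRatio_le_log_polyaRatio {p : A → ℝ} (hp : ∀ a, 0 ≤ p a) (hp1 : ∑ a, p a = 1)
    {δ : ℝ} (hδ : 0 < δ) (hpδ : ∀ a, 0 < p a → δ ≤ p a) {N : A → ℕ}
    (hpN : ∀ a, N a ≠ 0 → 0 < p a) {s : ℝ} (hs : 0 < s) (hsT : s ≤ ∑ a, (N a : ℝ))
    (hTs : ∑ a, (N a : ℝ) ≤ 2 * s) :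
    0 < polyaRatio p s N ∧
    maxLogRatio p N / 8 - Fintype.card A * Real.log (1 + 2 / δ) ≤
      Real.log (polyaRatio p s N) := by
  set T : ℝ := ∑ c, (N c : ℝ) with hT
  have hTpos : 0 < T := hs.trans_le hsT
  have hTN : ((∑ a, N a : ℕ) : ℝ) = T := by rw [hT]; push_cast; rfl
  have hfac : ∀ a, ∀ i ∈ Finset.range (N a), 0 < (s * p a + i) / p a := by
    intro a i hi
    have hpa := hpN a (by rintro h; simp [h] at hi)
    positivity
  have hnum : ∀ a, 0 < ∏ i ∈ Finset.range (N a), ((s * p a + i) / p a) := fun a =>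
    Finset.prod_pos (hfac a)
  have hden : 0 < ∏ i ∈ Finset.range (∑ a, N a), (s + (i : ℝ)) :=
    Finset.prod_pos fun i _ => by positivity
  have hpos : 0 < polyaRatio p s N := div_pos (Finset.prod_pos fun a _ => hnum a) hden
  refine ⟨hpos, ?_⟩
  have hlog : Real.log (polyaRatio p s N) =
      ∑ a, ∑ i ∈ Finset.range (N a), Real.log ((s * p a + i) / p a) -
        ∑ i ∈ Finset.range (∑ a, N a), Real.log (s + i) := by
    rw [polyaRatio, Real.log_div (Finset.prod_pos fun a _ => hnum a).ne' hden.ne',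
      Real.log_prod (fun a _ => (hnum a).ne'),
      Real.log_prod (s := Finset.range (∑ a, N a)) (fun i _ => by positivity)]
    congr 1
    exact Finset.sum_congr rfl fun a _ => Real.log_prod fun i hi => (hfac a i hi).ne'
  -- the contribution of a single letter
  have hletter : ∀ a, (s + T) * (p a * klFun (1 + T / (s + T) * (N a / (T * p a) - 1))) +
        (s * p a + N a) * Real.log (s + T) - T * p a - s * Real.log s * p a -
        Real.log (1 + 2 / δ) ≤
      ∑ i ∈ Finset.range (N a), Real.log ((s * p a + i) / p a) := by
    intro a
    have hlogδ : 0 ≤ Real.log (1 + 2 / δ) := Real.log_nonneg (by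
      have : 0 < 2 / δ := by positivity
      linarith)
    rcases (hp a).eq_or_lt with ha | ha
    · have hNa : N a = 0 := by
        by_contra h
        exact (hpN a h).ne ha
      rw [← ha, hNa]
      simp only [zero_mul, mul_zero, Finset.range_zero, Finset.sum_empty, Nat.cast_zero]
      linarith
    · have hsp : 0 < s * p a := by positivity
      have hsum := le_sum_log_add hsp (N a)
      have hsplit : ∑ i ∈ Finset.range (N a), Real.log ((s * p a + i) / p a) =
          ∑ i ∈ Finset.range (N a), Real.log (s * p a + i) - N a * Real.log (p a) := by
        rw [Finset.sum_congr rfl fun (i : ℕ) _ =>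
          Real.log_div (show s * p a + (i : ℝ) ≠ 0 by positivity) ha.ne']
        simp
      -- The Riemann sum error is bounded independently of the sample because `N a ≤ T ≤ 2 s` and `p
      -- a ≥ δ`.
      have hcost : Real.log (s * p a + N a) - Real.log (s * p a) ≤ Real.log (1 + 2 / δ) := by
        rw [← Real.log_div (by positivity) hsp.ne']
        refine Real.log_le_log (by positivity) ?_
        rw [add_div, div_self hsp.ne']
        gcongr 1 + ?_
        rw [div_le_div_iff₀ hsp hδ]
        have h1 : (N a : ℝ) ≤ T :=
          Finset.single_le_sum (f := fun c => (N c : ℝ)) (fun c _ => by positivity)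
            (Finset.mem_univ a)
        have h2 := hpδ a ha
        calc (N a : ℝ) * δ ≤ (2 * s) * p a := by
              gcongr
              linarith
          _ = 2 * (s * p a) := by ring
      -- The urn's smoothed frequency, relative to `p a`, is the empirical one with its deviation
      -- from 1 shrunk by `T / (s + T)`.
      have ht : 1 + T / (s + T) * (N a / (T * p a) - 1) =
          (s * p a + N a) / ((s + T) * p a) := by
        field_simp
        ring
      have hkl : (s + T) * (p a * klFun (1 + T / (s + T) * (N a / (T * p a) - 1))) =
          (s * p a + N a) * (Real.log (s * p a + N a) - (Real.log (s + T) + Real.log (p a))) +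
            (s + T) * p a - (s * p a + N a) := by
        rw [ht, klFun, Real.log_div (by positivity) (by positivity),
          Real.log_mul (by positivity) ha.ne']
        field_simp
      rw [hsplit, hkl]
      rw [Real.log_mul hs.ne' ha.ne'] at hsum hcost
      linear_combination hsum + hcost
  -- Each term is `T p a` times a `klFun` plus `N a - T p a`, which sums to zero over the letters.
  -- The shrinkage factor is at least 1/2 since `s ≤ T`.
  have hratio : ∀ a, N a * Real.log (N a / (T * p a)) ≤
      8 * ((s + T) * (p a * klFun (1 + T / (s + T) * (N a / (T * p a) - 1)))) +
        N a - T * p a := by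
    intro a
    rcases (hp a).eq_or_lt with ha | ha
    · have hNa : N a = 0 := by
        by_contra h
        exact (hpN a h).ne ha
      simp [← ha, hNa]
    · have hx : 0 ≤ N a / (T * p a) := by positivity
      have h1 := klFun_le_mul_klFun (β := T / (s + T)) (u := N a / (T * p a) - 1)
        (by rw [div_le_div_iff₀ (by norm_num) (by positivity)]; linarith)
        (by rw [div_le_one (by positivity)]; linarith) (by linarith)
      have h2 : N a * Real.log (N a / (T * p a)) =
          T * p a * klFun (1 + (N a / (T * p a) - 1)) + N a - T * p a := by
        rw [add_sub_cancel, klFun]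
        field_simp
        ring
      have h3 : 0 ≤ klFun (1 + T / (s + T) * (N a / (T * p a) - 1)) := by
        have := klFun_nonneg hx
        rw [add_sub_cancel] at h1
        linarith
      rw [h2]
      have h4 : T * p a * klFun (1 + (N a / (T * p a) - 1)) ≤
          T * p a * (8 * klFun (1 + T / (s + T) * (N a / (T * p a) - 1))) := by gcongr
      have h5 : 0 ≤ s * p a * klFun (1 + T / (s + T) * (N a / (T * p a) - 1)) := by positivity
      linarith
  have hsum1 := Finset.sum_le_sum fun a (_ : a ∈ Finset.univ) => hletter a
  have hsum2 := Finset.sum_le_sum fun a (_ : a ∈ Finset.univ) => hratio a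
  simp only [Finset.sum_sub_distrib, Finset.sum_add_distrib, ← Finset.mul_sum, ← Finset.sum_mul,
    hp1, ← hT, Finset.sum_const, Finset.card_univ, nsmul_eq_mul] at hsum1 hsum2
  have hsum3 := sum_log_add_le hs (∑ a, N a)
  rw [hTN] at hsum3
  rw [hlog, maxLogRatio, ← hT]
  linarith

end Polya

/-! ### Mixtures of Pólya urns -/

section Mixture

variable {A : Type*} [Fintype A]

/-- The mixture of the likelihood ratios of Pólya urns of initial masses `2 ^ k`. -/
def mixtureRatio (p : A → ℝ) (N : A → ℕ) : ENNReal :=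
  ∑' k : ℕ, ENNReal.ofReal (1 / ((k + 1) * (k + 2))) * ENNReal.ofReal (polyaRatio p (2 ^ k) N)

theorem mixtureRatio_zero_le_one (p : A → ℝ) : mixtureRatio p 0 ≤ 1 := by
  refine ENNReal.tsum_le_of_sum_range_le fun n => ?_
  have h : ∀ n : ℕ, ∑ k ∈ Finset.range n, (1 / (((k : ℝ) + 1) * (k + 2))) = 1 - 1 / (n + 1) := by
    intro n
    induction n with
    | zero => simp
    | succ n ih =>
      rw [Finset.sum_range_succ, ih]
      push_cast
      field_simp
      ring
  simp only [polyaRatio_zero, ENNReal.ofReal_one, mul_one]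
  rw [← ENNReal.ofReal_sum_of_nonneg fun k _ => by positivity, h, ← ENNReal.ofReal_one]
  refine ENNReal.ofReal_le_ofReal ?_
  have : 0 ≤ 1 / ((n : ℝ) + 1) := by positivity
  linarith

theorem PMF.sum_toReal (p : PMF A) : ∑ a, (p a).toReal = 1 := by
  rw [← ENNReal.toReal_sum fun a _ => p.apply_ne_top a, ← tsum_fintype (L := .unconditional A), PMF.tsum_coe,
    ENNReal.toReal_one]

theorem sum_mul_mixtureRatio_update_le [DecidableEq A] (p : PMF A) (N : A → ℕ) :
    ∑ a, p a * mixtureRatio (fun a => (p a).toReal) (N + Pi.single a 1) ≤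
      mixtureRatio (fun a => (p a).toReal) N := by
  have h0 : ∀ a, 0 ≤ (p a).toReal := fun a => ENNReal.toReal_nonneg
  simp only [mixtureRatio, ← ENNReal.tsum_mul_left]
  rw [← Summable.tsum_finsetSum fun a _ => ENNReal.summable]
  refine ENNReal.tsum_le_tsum fun k => ?_
  have h := sum_mul_polyaRatio_update_le h0 (PMF.sum_toReal p) (s := 2 ^ k) (by positivity) N
  calc ∑ a, p a * (ENNReal.ofReal (1 / ((k + 1) * (k + 2))) *
        ENNReal.ofReal (polyaRatio (fun a => (p a).toReal) (2 ^ k) (N + Pi.single a 1)))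
      = ENNReal.ofReal (1 / ((k + 1) * (k + 2))) * ENNReal.ofReal (∑ a, (p a).toReal *
          polyaRatio (fun a => (p a).toReal) (2 ^ k) (N + Pi.single a 1)) := by
        rw [ENNReal.ofReal_sum_of_nonneg fun a _ =>
          mul_nonneg (h0 a) (polyaRatio_nonneg h0 (by positivity) _), Finset.mul_sum]
        refine Finset.sum_congr rfl fun a _ => ?_
        rw [ENNReal.ofReal_mul (h0 a), ENNReal.ofReal_toReal (p.apply_ne_top a)]
        ring
    _ ≤ _ := by gcongr

/-- The cost, per context, of using a mixture in place of the maximum likelihood. -/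
def mixtureCost (A : Type*) [Fintype A] (δ : ℝ) (n : ℕ) : ℝ :=
  Fintype.card A * Real.log (1 + 2 / δ) + 2 * Real.log (Nat.log 2 n + 2)

/-- Only the component with `2 ^ k ≤ ∑ a, N a < 2 ^ (k + 1)` is kept. Its weight is at least
`(Nat.log 2 n + 2)⁻²`, which is the iterated-logarithm term of `mixtureCost`. -/
theorem le_mixtureRatio {p : A → ℝ} (hp : ∀ a, 0 ≤ p a) (hp1 : ∑ a, p a = 1)
    {δ : ℝ} (hδ : 0 < δ) (hpδ : ∀ a, 0 < p a → δ ≤ p a) {N : A → ℕ}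
    (hpN : ∀ a, N a ≠ 0 → 0 < p a) {n : ℕ} (hn : ∑ a, N a ≤ n) :
    ENNReal.ofReal (Real.exp (maxLogRatio p N / 8 - mixtureCost A δ n)) ≤ mixtureRatio p N := by
  set k := Nat.log 2 (∑ a, N a) with hk
  have hpolya : Real.exp (maxLogRatio p N / 8 - Fintype.card A * Real.log (1 + 2 / δ)) ≤
      polyaRatio p (2 ^ k) N := by
    by_cases hT : ∑ a, N a = 0
    · have hN : N = 0 := by
        funext a
        simpa using (Finset.sum_eq_zero_iff.1 hT) a (Finset.mem_univ a)
      have hlog : 0 ≤ Real.log (1 + 2 / δ) := Real.log_nonneg (by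
        have : 0 < 2 / δ := by positivity
        linarith)
      rw [hN, polyaRatio_zero, Real.exp_le_one_iff]
      have : 0 ≤ Fintype.card A * Real.log (1 + 2 / δ) := by positivity
      simpa [maxLogRatio] using this
    · have h1 : ((2 ^ k : ℕ) : ℝ) ≤ ((∑ a, N a : ℕ) : ℝ) :=
        Nat.cast_le.2 (Nat.pow_log_le_self 2 hT)
      have h2 : ((∑ a, N a : ℕ) : ℝ) ≤ ((2 ^ (k + 1) : ℕ) : ℝ) :=
        Nat.cast_le.2 (Nat.lt_pow_succ_log_self (by norm_num) _).le
      push_cast at h1 h2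
      rw [pow_succ] at h2
      have := maxLogRatio_le_log_polyaRatio hp hp1 hδ hpδ hpN (s := 2 ^ k) (by positivity)
        h1 (by linarith)
      rw [← Real.le_log_iff_exp_le this.1]
      exact this.2
  have hw : Real.exp (-(2 * Real.log (Nat.log 2 n + 2))) ≤ 1 / (((k : ℝ) + 1) * (k + 2)) := by
    have hkn : (k : ℝ) ≤ Nat.log 2 n := Nat.cast_le.2 (Nat.log_mono_right hn)
    rw [Real.exp_neg, mul_comm, Real.exp_mul, Real.exp_log (by positivity), Real.rpow_two,
      ← one_div]
    apply one_div_le_one_div_of_le (by positivity)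
    rw [sq]
    gcongr
    norm_num
  refine le_trans ?_ (ENNReal.le_tsum k)
  rw [← ENNReal.ofReal_mul (by positivity)]
  refine ENNReal.ofReal_le_ofReal ?_
  have : maxLogRatio p N / 8 - mixtureCost A δ n =
      -(2 * Real.log (Nat.log 2 n + 2)) +
        (maxLogRatio p N / 8 - Fintype.card A * Real.log (1 + 2 / δ)) := by
    rw [mixtureCost]; ring
  rw [this, Real.exp_add]
  gcongr

end Mixture

/-! ### Contexts -/

section Contexts

variable {A : Type*}

open Classical in
/-- The number of occurrences of the letter `a` after the word `b` in `x_{1:m+r}`. -/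
def count {r : ℕ} (m : ℕ) (ω : ℕ → A) (b : Fin r → A) (a : A) : ℕ :=
  ((Finset.range m).filter fun j => block ω j r = b ∧ ω (j + r) = a).card

theorem count_congr {r m : ℕ} {x y : ℕ → A} (h : ∀ i < m + r, x i = y i) (b : Fin r → A) :
    count m x b = count m y b := by
  classical
  funext a
  refine congrArg Finset.card (Finset.filter_congr fun j hj => ?_)
  rw [Finset.mem_range] at hj
  rw [h (j + r) (by omega), block_congr (y := y) fun i hi => h i (by omega)]

theorem count_zero {r : ℕ} (ω : ℕ → A) (b : Fin r → A) : count 0 ω b = 0 := by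
  funext a
  simp [count]

theorem count_succ_update_self [DecidableEq A] {r : ℕ} (m : ℕ) (ω : ℕ → A) (a : A) :
    count (m + 1) (Function.update ω (m + r) a) (block ω m r) =
      count m ω (block ω m r) + Pi.single a 1 := by
  classical
  funext c
  have h := congrFun (count_congr (m := m) (x := Function.update ω (m + r) a)
    (y := ω) (fun i hi => Function.update_of_ne hi.ne _ _) (block ω m r)) c
  rw [Pi.add_apply, ← h]
  simp only [count]
  rw [Finset.range_add_one, Finset.filter_insert]
  by_cases hc : a = c
  · subst hc
    rw [if_pos ⟨block_update le_rfl a, Function.update_self _ _ _⟩, Finset.card_insert_of_notMem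
      (by simp), Pi.single_eq_same]
  · rw [if_neg (by simp [hc]), Pi.single_eq_of_ne (Ne.symm hc), add_zero]

theorem count_succ_update_of_ne {r : ℕ} (m : ℕ) (ω : ℕ → A) (a : A) {b : Fin r → A}
    (hb : b ≠ block ω m r) :
    count (m + 1) (Function.update ω (m + r) a) b = count m ω b := by
  classical
  rw [← count_congr (m := m) (x := Function.update ω (m + r) a)
    (y := ω) (fun i hi => Function.update_of_ne hi.ne _ _) b]
  funext c
  simp only [count]
  rw [Finset.range_add_one, Finset.filter_insert, if_neg]
  rw [block_update le_rfl]
  exact fun h => hb h.1.symm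

theorem sum_count_le [Fintype A] {r : ℕ} (m : ℕ) (ω : ℕ → A) (b : Fin r → A) :
    ∑ a, count m ω b a ≤ m := by
  classical
  simp only [count]
  rw [← Finset.card_biUnion]
  · exact (Finset.card_le_card (t := Finset.range m) (by
      intro j; simp only [Finset.mem_biUnion, Finset.mem_filter]; tauto)).trans (by simp)
  · intro a _ c _ hac
    refine Finset.disjoint_left.2 fun j hj hj' => hac ?_
    rw [Finset.mem_filter] at hj hj'
    rw [← hj.2.2, hj'.2.2]

theorem sum_range_eq_sum_count_mul [Fintype A] {r : ℕ} (m : ℕ) (ω : ℕ → A)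
    (h : (Fin r → A) → A → ℝ) :
    ∑ j ∈ Finset.range m, h (block ω j r) (ω (j + r)) =
      ∑ b, ∑ a, count m ω b a * h b a := by
  classical
  rw [← Fintype.sum_prod_type',
    ← Finset.sum_fiberwise (Finset.range m) fun j => (block ω j r, ω (j + r))]
  refine Finset.sum_congr rfl fun x _ => ?_
  rw [count, ← nsmul_eq_mul, ← Finset.sum_const]
  simp only [Prod.ext_iff]
  refine Finset.sum_congr rfl fun j hj => ?_
  rw [(Finset.mem_filter.1 hj).2.1, (Finset.mem_filter.1 hj).2.2]

theorem exists_of_count_ne_zero {r m : ℕ} {ω : ℕ → A} {b : Fin r → A} {a : A}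
    (h : count m ω b a ≠ 0) : ∃ j < m, block ω j r = b ∧ ω (j + r) = a := by
  classical
  obtain ⟨j, hj⟩ := Finset.card_ne_zero.1 h
  rw [Finset.mem_filter, Finset.mem_range] at hj
  exact ⟨j, hj⟩

/-- The last `r` letters of a word. -/
def suffix {n : ℕ} (r : ℕ) (h : r ≤ n) (x : Fin n → A) : Fin r → A :=
  fun i => x ⟨n - r + i, by omega⟩

theorem suffix_block {n r : ℕ} (h : r ≤ n) (x : ℕ → A) (m : ℕ) :
    suffix r h (block x m n) = block x (m + (n - r)) r := by
  funext i
  simp [suffix, block, add_assoc]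

variable [MeasurableSpace A] {P : Measure (ℕ → A)} {r : ℕ} {q : (Fin r → A) → PMF A}

theorem isTransition_of_succ
    (h : ∀ (m : ℕ) (x : ℕ → A), wordProb P (block x 0 (m + r + 1)) =
      wordProb P (block x 0 (m + r)) * q (block x m r) (x (m + r))) : IsTransition P r q := by
  intro m x
  induction m with
  | zero => simp
  | succ m ih =>
    rw [Finset.prod_range_succ, ← mul_assoc, ← ih, ← show m + r + 1 = r + (m + 1) by omega, h,
      add_comm m r]

/-- A chain of order `r` is also one of any order `n ≥ r`, so the true law can serve as the
reference law of the urns in every larger model. -/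
theorem IsTransition.suffix (hq : IsTransition P r q) {n : ℕ} (h : r ≤ n) :
    IsTransition P n fun b => q (suffix r h b) := by
  refine isTransition_of_succ fun m x => ?_
  have := hq.wordProb_succ (m + (n - r)) x
  rw [show m + (n - r) + r = m + n by omega] at this
  rw [this, suffix_block]

end Contexts

/-! ### The mixture likelihood -/

section Overestimation

variable {A : Type*} [Fintype A] {r : ℕ}

/-- The likelihood ratio of `x_{1:m+r}` for the chain of order `r` whose transition probabilities
are independent mixtures of Pólya urns. -/
def mixtureLikelihood (q : (Fin r → A) → PMF A) (m : ℕ) (ω : ℕ → A) : ENNReal :=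
  ∏ b, mixtureRatio (fun a => (q b a).toReal) (count m ω b)

theorem dependsOn_mixtureLikelihood (q : (Fin r → A) → PMF A) (m : ℕ) :
    DependsOn (mixtureLikelihood q m) (Set.Iio (m + r)) := by
  intro x y h
  simp only [mixtureLikelihood, count_congr (m := m) (x := x) (y := y) h]

/-- A new letter changes only the factor of the current context, so the one-urn inequality passes to
the product. -/
theorem sum_mul_mixtureLikelihood_update_le (q : (Fin r → A) → PMF A) (m : ℕ) (ω : ℕ → A) :
    ∑ a, q (block ω m r) a * mixtureLikelihood q (m + 1) (Function.update ω (m + r) a) ≤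
      mixtureLikelihood q m ω := by
  classical
  simp only [mixtureLikelihood]
  set u := block ω m r with hu
  have h : ∀ a, ∏ b, mixtureRatio (fun a => (q b a).toReal)
        (count (m + 1) (Function.update ω (m + r) a) b) =
      mixtureRatio (fun a => (q u a).toReal) (count m ω u + Pi.single a 1) *
        ∏ b ∈ Finset.univ.erase u, mixtureRatio (fun a => (q b a).toReal) (count m ω b) := by
    intro a
    rw [← Finset.mul_prod_erase _ _ (Finset.mem_univ u), count_succ_update_self]
    congr 1
    refine Finset.prod_congr rfl fun b hb => ?_
    rw [count_succ_update_of_ne m ω a (Finset.ne_of_mem_erase hb)]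
  simp only [h, ← mul_assoc]
  rw [← Finset.sum_mul, ← Finset.mul_prod_erase Finset.univ
    (fun b => mixtureRatio (fun a => (q b a).toReal) (count m ω b)) (Finset.mem_univ u)]
  gcongr
  exact sum_mul_mixtureRatio_update_le (q u) _

variable [MeasurableSpace A] {P : Measure (ℕ → A)} {q : (Fin r → A) → PMF A}

theorem IsTransition.mul_measure_exists_le_mixtureLikelihood [Nonempty A]
    [MeasurableSingletonClass A] [IsProbabilityMeasure P] (hq : IsTransition P r q)
    (t : ENNReal) : t * P {ω | ∃ m, t ≤ mixtureLikelihood q m ω} ≤ 1 := by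
  classical
  have h0 : ∫⁻ ω, mixtureLikelihood q 0 ω ∂P ≤ 1 := by
    calc ∫⁻ ω, mixtureLikelihood q 0 ω ∂P ≤ ∫⁻ _, 1 ∂P := by
          refine lintegral_mono fun ω => ?_
          simp only [mixtureLikelihood, count_zero]
          exact Finset.prod_le_one' fun b _ => mixtureRatio_zero_le_one _
      _ = 1 := by simp
  refine (mul_measure_exists_le_lintegral (dependsOn_mixtureLikelihood q) ?_ t).trans h0
  intro m E hE
  have hEm : MeasurableSet E := measurable_of_dependsOn hE (measurableSet_singleton True) |>.congr
    (by ext; simp)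
  rw [← lintegral_indicator hEm, ← lintegral_indicator hEm, hq.lintegral_eq (m := m)]
  · refine lintegral_mono fun ω => ?_
    have hmem : ∀ a, Function.update ω (m + r) a ∈ E ↔ ω ∈ E := fun a =>
      iff_of_eq (hE fun i hi => Function.update_of_ne (by simp at hi; omega) _ _)
    by_cases hω : ω ∈ E
    · simp only [Set.indicator_apply, hmem, hω, if_true]
      exact sum_mul_mixtureLikelihood_update_le q m ω
    · simp [hmem, hω]
  · intro x y hxy
    simp only [Set.mem_Iio] at hxy
    have h1 : x ∈ E ↔ y ∈ E := iff_of_eq (hE fun i hi => hxy i (by simp at hi; omega))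
    have h2 := dependsOn_mixtureLikelihood q (m + 1) (x := x) (y := y)
      fun i hi => hxy i (by simp at hi; omega)
    simp only [Set.indicator_apply, h1, h2]

/-- The maximal likelihood of order `r` exceeds the likelihood of the true law by no more than
what the mixture likelihood allows. -/
theorem IsTransition.wordProb_mul_le (hq : IsTransition P r q)
    {δ : ℝ} (hδ : 0 < δ) (hqδ : ∀ b a, 0 < q b a → δ ≤ (q b a).toReal) {ω : ℕ → A}
    (hω : ∀ n, 0 < wordProb P (block ω 0 n)) {t : ℝ} (ht : 0 < t) {m : ℕ}
    (hmix : mixtureLikelihood q m ω ≤ ENNReal.ofReal t) {Q : Measure (ℕ → A)}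
    (hQ : Q ∈ markovLaws A r) :
    wordProb Q (block ω 0 (r + m)) * wordProb P (block ω 0 r) ≤
      ENNReal.ofReal (Real.exp (8 * (Real.log t +
        (Fintype.card A : ℝ) ^ r * mixtureCost A δ m))) * wordProb P (block ω 0 (r + m)) := by
  classical
  obtain ⟨_, p, hp⟩ := hQ
  have hqpos := hq.pos_of_wordProb_pos hω
  rw [hp m ω, hq m ω]
  -- If `Q` forbids an observed transition its likelihood is zero. Otherwise logarithms may be
  -- taken.
  by_cases hzero : ∃ j < m, p (block ω j r) (ω (j + r)) = 0
  · obtain ⟨j, hj, hj0⟩ := hzero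
    rw [Finset.prod_eq_zero (Finset.mem_range.2 hj) hj0]
    simp
  push Not at hzero
  set L : ℝ := ∑ b, maxLogRatio (fun a => (q b a).toReal) (count m ω b) with hL
  have hcq : ∀ b a, count m ω b a ≠ 0 → 0 < (q b a).toReal := by
    intro b a h
    obtain ⟨j, _, rfl, rfl⟩ := exists_of_count_ne_zero h
    exact ENNReal.toReal_pos (hqpos j).ne' ((q _).apply_ne_top _)
  have hcp : ∀ b a, count m ω b a ≠ 0 → 0 < (p b a).toReal := by
    intro b a h
    obtain ⟨j, hj, rfl, rfl⟩ := exists_of_count_ne_zero h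
    exact ENNReal.toReal_pos (hzero j hj) ((p _).apply_ne_top _)
  have hLt : L ≤ 8 * (Real.log t + (Fintype.card A : ℝ) ^ r * mixtureCost A δ m) := by
    have h1 : ENNReal.ofReal (Real.exp (∑ b : Fin r → A,
        (maxLogRatio (fun a => (q b a).toReal) (count m ω b) / 8 - mixtureCost A δ m))) ≤
        mixtureLikelihood q m ω := by
      rw [Real.exp_sum, ENNReal.ofReal_prod_of_nonneg fun b _ => (Real.exp_pos _).le]
      refine Finset.prod_le_prod' fun b _ => ?_
      exact le_mixtureRatio (fun a => ENNReal.toReal_nonneg) (PMF.sum_toReal _) hδ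
        (fun a ha => hqδ b a (ENNReal.toReal_pos_iff.1 ha).1) (hcq b) (sum_count_le m ω b)
    have h2 := (ENNReal.ofReal_le_ofReal_iff ht.le).1 (h1.trans hmix)
    rw [← Real.le_log_iff_exp_le ht, Finset.sum_sub_distrib, ← Finset.sum_div, ← hL] at h2
    simp only [Finset.sum_const, Finset.card_univ, Fintype.card_fun, Fintype.card_fin,
      nsmul_eq_mul, Nat.cast_pow] at h2
    linarith
  have hprod : ∏ j ∈ Finset.range m, p (block ω j r) (ω (j + r)) ≤
      ENNReal.ofReal (Real.exp L) * ∏ j ∈ Finset.range m, q (block ω j r) (ω (j + r)) := by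
    have h1 : ∑ j ∈ Finset.range m, Real.log
        ((p (block ω j r) (ω (j + r))).toReal / (q (block ω j r) (ω (j + r))).toReal) ≤ L := by
      rw [sum_range_eq_sum_count_mul m ω fun b a =>
        Real.log ((p b a).toReal / (q b a).toReal)]
      exact Finset.sum_le_sum fun b _ => sum_mul_log_div_le_maxLogRatio
        (fun a => ENNReal.toReal_nonneg) (PMF.sum_toReal _) (hcq b) (hcp b)
    have h2 : ∀ j ∈ Finset.range m, p (block ω j r) (ω (j + r)) =
        ENNReal.ofReal (Real.exp (Real.log ((p (block ω j r) (ω (j + r))).toReal /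
          (q (block ω j r) (ω (j + r))).toReal))) * q (block ω j r) (ω (j + r)) := by
      intro j hj
      have hpj := ENNReal.toReal_pos (hzero j (Finset.mem_range.1 hj)) ((p _).apply_ne_top _)
      have hqj := ENNReal.toReal_pos (hqpos j).ne' ((q _).apply_ne_top _)
      rw [Real.exp_log (by positivity)]
      conv_rhs => rw [← ENNReal.ofReal_toReal ((q (block ω j r)).apply_ne_top (ω (j + r)))]
      rw [← ENNReal.ofReal_mul (by positivity), ENNReal.toReal_ofReal hqj.le,
        div_mul_cancel₀ _ hqj.ne', ENNReal.ofReal_toReal ((p _).apply_ne_top _)]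
    rw [Finset.prod_congr rfl h2, Finset.prod_mul_distrib,
      ← ENNReal.ofReal_prod_of_nonneg fun b _ => (Real.exp_pos _).le, ← Real.exp_sum]
    gcongr
  calc wordProb Q (block ω 0 r) * (∏ j ∈ Finset.range m, p (block ω j r) (ω (j + r))) *
        wordProb P (block ω 0 r)
      ≤ 1 * (ENNReal.ofReal (Real.exp (8 * (Real.log t +
        (Fintype.card A : ℝ) ^ r * mixtureCost A δ m))) *
          ∏ j ∈ Finset.range m, q (block ω j r) (ω (j + r))) * wordProb P (block ω 0 r) := by
        gcongr
        · exact wordProb_le_one Q _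
        · refine hprod.trans ?_
          gcongr
    _ = _ := by ring

end Overestimation

/-! ### Almost sure bounds on the likelihood ratio, uniform in the order -/

section Overestimation

variable {A : Type*} [Fintype A] [MeasurableSpace A] {P : Measure (ℕ → A)} {r : ℕ}
  {q : (Fin r → A) → PMF A}

theorem exists_pos_forall_le {ι : Type*} [Finite ι] (f : ι → ℝ) :
    ∃ c : ℝ, 0 < c ∧ ∀ i, 0 < f i → c ≤ f i := by
  classical
  cases nonempty_fintype ι
  rcases (Finset.univ.filter fun i => 0 < f i).eq_empty_or_nonempty with h | h
  · refine ⟨1, one_pos, fun i hi => ?_⟩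
    exact absurd (Finset.mem_filter.2 ⟨Finset.mem_univ i, hi⟩) (h ▸ Finset.notMem_empty i)
  · obtain ⟨i, hi, hmin⟩ := Finset.exists_min_image _ f h
    exact ⟨f i, (Finset.mem_filter.1 hi).2, fun j hj =>
      hmin j (Finset.mem_filter.2 ⟨Finset.mem_univ j, hj⟩)⟩

/-- Almost surely the mixture likelihoods of all orders are simultaneously under control. -/
theorem IsTransition.ae_exists_mixtureLikelihood_le [Nonempty A] [MeasurableSingletonClass A]
    [IsProbabilityMeasure P] (hq : IsTransition P r q) :
    ∀ᵐ ω ∂P, ∃ K : ℕ, 0 < K ∧ ∀ (n : ℕ) (h : r ≤ n) (m : ℕ),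
      mixtureLikelihood (fun b => q (MarkovOrder.suffix r h b)) m ω ≤ K * 2 ^ n := by
  let Z : ℕ → ℕ → (ℕ → A) → ENNReal := fun d =>
    mixtureLikelihood fun b => q (MarkovOrder.suffix r (Nat.le_add_right r d) b)
  -- The factor `2 ^ d` makes the union bound over orders `r + d` summable; it later costs only a
  -- term linear in the order.
  let B : ℕ → Set (ℕ → A) := fun K => ⋃ d, {ω | ∃ m, ((K + 1 : ℕ) : ENNReal) * 2 ^ d ≤ Z d m ω}
  have hB : ∀ K : ℕ, P (B K) ≤ 2 * ((K + 1 : ℕ) : ENNReal)⁻¹ := by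
    intro K
    have h1 : ∀ d : ℕ, P {ω | ∃ m, ((K + 1 : ℕ) : ENNReal) * 2 ^ d ≤ Z d m ω} ≤
        ((K + 1 : ℕ) : ENNReal)⁻¹ * 2⁻¹ ^ d := by
      intro d
      have := (hq.suffix (Nat.le_add_right r d)).mul_measure_exists_le_mixtureLikelihood
        (((K + 1 : ℕ) : ENNReal) * 2 ^ d)
      rw [mul_comm, ← ENNReal.le_inv_iff_mul_le] at this
      refine this.trans_eq ?_
      rw [ENNReal.mul_inv (by simp) (by simp), ENNReal.inv_pow]
    calc P (B K) ≤ ∑' d, P {ω | ∃ m, ((K + 1 : ℕ) : ENNReal) * 2 ^ d ≤ Z d m ω} :=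
          measure_iUnion_le _
      _ ≤ ∑' d : ℕ, ((K + 1 : ℕ) : ENNReal)⁻¹ * 2⁻¹ ^ d := ENNReal.tsum_le_tsum h1
      _ = _ := by
          rw [ENNReal.tsum_mul_left, ENNReal.tsum_geometric, ENNReal.one_sub_inv_two, inv_inv,
            mul_comm]
  have hnull : P (⋂ K, B K) = 0 := by
    have hlim : Tendsto (fun K : ℕ => 2 * ((K + 1 : ℕ) : ENNReal)⁻¹) atTop (𝓝 0) := by
      have := (tendsto_add_atTop_iff_nat 1).2 ENNReal.tendsto_inv_nat_nhds_zero
      simpa using ENNReal.Tendsto.const_mul this (Or.inr (ENNReal.ofNat_ne_top (n := 2)))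
    refine le_antisymm (ge_of_tendsto' hlim fun K => ?_) zero_le
    exact (measure_mono (Set.iInter_subset _ K)).trans (hB K)
  have hae : ∀ᵐ ω ∂P, ω ∉ ⋂ K, B K := measure_eq_zero_iff_ae_notMem.1 hnull
  filter_upwards [hae] with ω hω
  simp only [B, Set.mem_iInter, Set.mem_iUnion, Set.mem_ofPred_eq, not_forall, not_exists,
    not_le] at hω
  obtain ⟨K, hK⟩ := hω
  refine ⟨K + 1, K.succ_pos, fun n h m => ?_⟩
  obtain ⟨d, rfl⟩ := Nat.exists_eq_add_of_le h
  refine (hK d m).le.trans ?_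
  gcongr
  · norm_num
  · omega

/-- Words of positive probability have at least exponentially small probability. -/
theorem IsTransition.exists_exp_le_wordProb [IsProbabilityMeasure P] (hq : IsTransition P r q) :
    ∃ C : ℝ, 0 < C ∧ ∀ ω : ℕ → A, (∀ n, 0 < wordProb P (block ω 0 n)) → ∀ n, r ≤ n →
      ENNReal.ofReal (Real.exp (-(C * (n + 1)))) ≤ wordProb P (block ω 0 n) := by
  obtain ⟨ε, hε, hεle⟩ := exists_pos_forall_le fun u : Fin r → A => (wordProb P u).toReal
  obtain ⟨δ, hδ, hδle⟩ := exists_pos_forall_le fun x : (Fin r → A) × A => (q x.1 x.2).toReal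
  refine ⟨|Real.log ε| + |Real.log δ| + 1, by positivity, fun ω hω n hn => ?_⟩
  obtain ⟨m, rfl⟩ := Nat.exists_eq_add_of_le hn
  have h1 : ENNReal.ofReal ε ≤ wordProb P (block ω 0 r) :=
    ENNReal.ofReal_le_of_le_toReal (hεle _ (ENNReal.toReal_pos (hω r).ne'
      ((wordProb_le_one P _).trans_lt ENNReal.one_lt_top).ne))
  have h2 : ENNReal.ofReal δ ^ m ≤ ∏ j ∈ Finset.range m, q (block ω j r) (ω (j + r)) := by
    calc ENNReal.ofReal δ ^ m = ∏ j ∈ Finset.range m, ENNReal.ofReal δ := by simp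
      _ ≤ _ := Finset.prod_le_prod' fun j _ => ENNReal.ofReal_le_of_le_toReal
          (hδle (block ω j r, ω (j + r)) (ENNReal.toReal_pos (hq.pos_of_wordProb_pos hω j).ne'
            ((q _).apply_ne_top _)))
  rw [hq m ω]
  refine le_trans ?_ (mul_le_mul' h1 h2)
  rw [← ENNReal.ofReal_pow hδ.le, ← ENNReal.ofReal_mul hε.le]
  refine ENNReal.ofReal_le_ofReal ?_
  rw [← Real.le_log_iff_exp_le (by positivity), Real.log_mul (by positivity) (by positivity),
    Real.log_pow]
  push_cast
  have h3 := neg_abs_le (Real.log ε)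
  have h4 := neg_abs_le (Real.log δ)
  have h5 := abs_nonneg (Real.log ε)
  have h6 := abs_nonneg (Real.log δ)
  have h7 : (0 : ℝ) ≤ m := by positivity
  have h8 : (0 : ℝ) ≤ r := by positivity
  nlinarith [mul_nonneg h5 h7, mul_nonneg h5 h8, mul_nonneg h6 h8,
    mul_nonneg h7 (by linarith : 0 ≤ Real.log δ + |Real.log δ|)]

theorem mixtureCost_mono (A : Type*) [Fintype A] (δ : ℝ) {m n : ℕ} (h : m ≤ n) :
    mixtureCost A δ m ≤ mixtureCost A δ n := by
  have : (Nat.log 2 m : ℝ) ≤ Nat.log 2 n := Nat.cast_le.2 (Nat.log_mono_right h)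
  rw [mixtureCost, mixtureCost]
  gcongr

/-- The likelihood ratios of all orders obey a common bound of iterated logarithmic size. -/
theorem IsTransition.ae_exists_wordProb_le [Nonempty A] [MeasurableSingletonClass A]
    [IsProbabilityMeasure P] (hq : IsTransition P r q) :
    ∃ δ : ℝ, 0 < δ ∧ ∀ᵐ ω ∂P, ∃ D : ℝ, 0 < D ∧ ∀ n k : ℕ, r ≤ k → k ≤ n →
      ∀ Q ∈ markovLaws A k, wordProb Q (block ω 0 n) ≤
        ENNReal.ofReal (Real.exp (D * (k + 1) +
          8 * (Fintype.card A : ℝ) ^ k * mixtureCost A δ n)) * wordProb P (block ω 0 n) := by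
  obtain ⟨δ, hδ, hδle⟩ := exists_pos_forall_le fun x : (Fin r → A) × A => (q x.1 x.2).toReal
  obtain ⟨C, hC, hCle⟩ := hq.exists_exp_le_wordProb
  refine ⟨δ, hδ, ?_⟩
  filter_upwards [hq.ae_exists_mixtureLikelihood_le, ae_wordProb_pos P] with ω hmix hpos
  obtain ⟨K, hK, hmix⟩ := hmix
  -- `C` pays for the probability of the initial word of length `k` under `P`; the rest is `8 log t`
  -- for the threshold `t = K 2 ^ k`.
  refine ⟨C + 8 * (Real.log K + Real.log 2), ?_, ?_⟩
  · have h1 : 0 ≤ Real.log K := Real.log_natCast_nonneg K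
    have h2 : 0 < Real.log 2 := Real.log_pos (by norm_num)
    positivity
  intro n k hk hkn Q hQ
  obtain ⟨m, rfl⟩ := Nat.exists_eq_add_of_le hkn
  have hKpos : (0 : ℝ) < K := by exact_mod_cast hK
  have h1 := (hq.suffix hk).wordProb_mul_le hδ
    (fun b a hba => hδle (MarkovOrder.suffix r hk b, a)
      (ENNReal.toReal_pos hba.ne' ((q _).apply_ne_top _))) hpos
    (t := K * 2 ^ k) (by positivity) (m := m)
    ((hmix k hk m).trans_eq (by
      rw [ENNReal.ofReal_mul (by positivity), ENNReal.ofReal_natCast,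
        ENNReal.ofReal_pow (by norm_num), ENNReal.ofReal_ofNat])) hQ
  have h2 := hCle ω hpos k hk
  have hlog : Real.log (K * 2 ^ k) = Real.log K + k * Real.log 2 := by
    rw [Real.log_mul (by positivity) (by positivity), Real.log_pow]
  have h3 : (1 : ENNReal) = ENNReal.ofReal (Real.exp (C * (k + 1))) *
      ENNReal.ofReal (Real.exp (-(C * (k + 1)))) := by
    rw [← ENNReal.ofReal_mul (by positivity), ← Real.exp_add, add_neg_cancel, Real.exp_zero,
      ENNReal.ofReal_one]
  calc wordProb Q (block ω 0 (k + m))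
      = ENNReal.ofReal (Real.exp (C * (k + 1))) * (wordProb Q (block ω 0 (k + m)) *
          ENNReal.ofReal (Real.exp (-(C * (k + 1))))) := by
        rw [mul_left_comm, ← h3, mul_one]
    _ ≤ ENNReal.ofReal (Real.exp (C * (k + 1))) *
        (ENNReal.ofReal (Real.exp (8 * (Real.log (K * 2 ^ k) +
          (Fintype.card A : ℝ) ^ k * mixtureCost A δ m))) * wordProb P (block ω 0 (k + m))) := by
        refine mul_le_mul_right (le_trans ?_ h1) _
        gcongr
    _ ≤ _ := by
        rw [← mul_assoc, ← ENNReal.ofReal_mul (by positivity), ← Real.exp_add, hlog]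
        refine mul_le_mul_left (ENNReal.ofReal_le_ofReal (Real.exp_le_exp.2 ?_)) _
        have h4 : 0 ≤ Real.log K := Real.log_natCast_nonneg K
        have h5 : 0 < Real.log 2 := Real.log_pos (by norm_num)
        have h6 : (Fintype.card A : ℝ) ^ k * mixtureCost A δ m ≤
            (Fintype.card A : ℝ) ^ k * mixtureCost A δ (k + m) := by
          gcongr
          exact mixtureCost_mono A δ (by omega)
        have h7 : (0 : ℝ) ≤ k := by positivity
        nlinarith [mul_nonneg h4 h7]

end Overestimation

/-! ### Comparison of penalized likelihoods -/

section Comparison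

variable {A : Type*} [MeasurableSpace A] {P : Measure (ℕ → A)}

theorem maxLogLik_le [IsProbabilityMeasure P] {k n : ℕ} {x : Fin n → A} {B : ℝ}
    (hx : 0 < wordProb P x)
    (h : ∀ Q ∈ markovLaws A k, wordProb Q x ≤ ENNReal.ofReal (Real.exp B) * wordProb P x) :
    maxLogLik k x ≤ ((Real.log (wordProb P x).toReal + B : ℝ) : EReal) := by
  have htop : wordProb P x ≠ ⊤ := ((wordProb_le_one P x).trans_lt ENNReal.one_lt_top).ne
  have hpos := ENNReal.toReal_pos hx.ne' htop
  refine iSup₂_le fun Q hQ => (ENNReal.log_monotone (h Q hQ)).trans_eq ?_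
  rw [← ENNReal.ofReal_toReal htop, ← ENNReal.ofReal_mul (by positivity),
    ENNReal.toReal_ofReal hpos.le, ENNReal.log_ofReal, if_neg (by push Not; positivity),
    Real.log_mul (by positivity) (by positivity), Real.log_exp, add_comm]

theorem le_maxLogLik [IsProbabilityMeasure P] {k n : ℕ} {x : Fin n → A}
    (hP : P ∈ markovLaws A k) (hx : 0 < wordProb P x) :
    ((Real.log (wordProb P x).toReal : ℝ) : EReal) ≤ maxLogLik k x := by
  have htop : wordProb P x ≠ ⊤ := ((wordProb_le_one P x).trans_lt ENNReal.one_lt_top).ne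
  have hpos := ENNReal.toReal_pos hx.ne' htop
  refine le_trans (le_of_eq ?_) (le_iSup₂_of_le P hP le_rfl)
  conv_rhs => rw [← ENNReal.ofReal_toReal htop]
  rw [ENNReal.log_ofReal, if_neg (by push Not; exact hpos)]

/-- The selected order competes with the order `r`, whose maximal likelihood is at least that of
`P`. Both kinds of error are excluded by contradicting this inequality. -/
theorem IsPenalizedLikelihoodEstimator.pen_le {pen : ℕ → ℕ → ℝ} {κ : ℕ → ℝ}
    {rhat : (n : ℕ) → (Fin n → A) → ℕ} (hr : IsPenalizedLikelihoodEstimator pen κ rhat)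
    [IsProbabilityMeasure P] {r n : ℕ} {x : Fin n → A} (hP : P ∈ markovLaws A r)
    (hκ : (r : ℝ) < κ n) (hx : 0 < wordProb P x) {B : ℝ}
    (h : ∀ Q ∈ markovLaws A (rhat n x),
      wordProb Q x ≤ ENNReal.ofReal (Real.exp B) * wordProb P x) :
    pen n (rhat n x) ≤ pen n r + B := by
  have hmax := (hr n x ((Nat.cast_nonneg r).trans_lt hκ)).2 hκ
  have h1 : ((Real.log (wordProb P x).toReal : ℝ) : EReal) - (pen n r : EReal) ≤
      ((Real.log (wordProb P x).toReal + B : ℝ) : EReal) - (pen n (rhat n x) : EReal) :=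
    (EReal.sub_le_sub (le_maxLogLik hP hx) le_rfl).trans
      (le_trans hmax (EReal.sub_le_sub (maxLogLik_le hx h) le_rfl))
  rw [← EReal.coe_sub, ← EReal.coe_sub, EReal.coe_le_coe_iff] at h1
  linarith

end Comparison

/-! ### Hellinger affinities of transition kernels -/

section Affinity

variable {A : Type*} {R : ℕ}

/-- The successor of the state `u` when the letter `a` is read. -/
def next (u : Fin R → A) (a : A) : Fin R → A :=
  fun i => if h : (i : ℕ) + 1 < R then u ⟨i + 1, h⟩ else a

theorem next_block (ω : ℕ → A) (m : ℕ) :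
    next (block ω m R) (ω (m + R)) = block ω (m + 1) R := by
  funext i
  have hi := i.2
  by_cases h : (i : ℕ) + 1 < R
  · simp [next, block, h, add_assoc, add_comm 1]
  · have : m + 1 + (i : ℕ) = m + R := by omega
    simp [next, block, h, this]

variable [Fintype A]

/-- The affinity of the laws of the next `k` letters under the kernels `g` and `p`. -/
def affinity (g p : (Fin R → A) → A → ℝ) : ℕ → (Fin R → A) → ℝ
  | 0, _ => 1
  | k + 1, u => ∑ a, Real.sqrt (g u a * p u a) * affinity g p k (next u a)

theorem affinity_nonneg (g p : (Fin R → A) → A → ℝ) (k : ℕ) (u : Fin R → A) :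
    0 ≤ affinity g p k u := by
  induction k generalizing u with
  | zero => exact zero_le_one
  | succ k ih => exact Finset.sum_nonneg fun a _ => mul_nonneg (Real.sqrt_nonneg _) (ih _)

theorem continuous_affinity {X : Type*} [TopologicalSpace X] {g : X → (Fin R → A) → A → ℝ}
    (hg : ∀ u a, Continuous fun x => g x u a) (p : (Fin R → A) → A → ℝ) (k : ℕ)
    (u : Fin R → A) : Continuous fun x => affinity (g x) p k u := by
  induction k generalizing u with
  | zero => exact continuous_const
  | succ k ih =>
    exact continuous_finsetSum _ fun a _ =>
      (Real.continuous_sqrt.comp ((hg u a).mul continuous_const)).mul (ih _)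

theorem sqrt_mul_le_half_add {x y : ℝ} (hx : 0 ≤ x) (hy : 0 ≤ y) :
    Real.sqrt (x * y) ≤ (x + y) / 2 := by
  rw [Real.sqrt_le_left (by positivity)]
  nlinarith [sq_nonneg (x - y)]

theorem sqrt_mul_lt_half_add {x y : ℝ} (hx : 0 ≤ x) (hy : 0 ≤ y) (hxy : x ≠ y) :
    Real.sqrt (x * y) < (x + y) / 2 := by
  have h : 0 < (x - y) ^ 2 := by
    have := sub_ne_zero.2 hxy
    positivity
  have hpos : 0 < (x + y) / 2 := by
    by_contra! hle
    exact hxy (by linarith)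
  rw [Real.sqrt_lt' hpos]
  nlinarith

variable {g p : (Fin R → A) → A → ℝ}

theorem sum_sqrt_mul_le_one {x y : A → ℝ} (hx : ∀ a, 0 ≤ x a) (hx1 : ∑ a, x a = 1)
    (hy : ∀ a, 0 ≤ y a) (hy1 : ∑ a, y a = 1) : ∑ a, Real.sqrt (x a * y a) ≤ 1 := by
  refine (Finset.sum_le_sum fun a _ => sqrt_mul_le_half_add (hx a) (hy a)).trans_eq ?_
  rw [← Finset.sum_div, Finset.sum_add_distrib, hx1, hy1]
  norm_num

theorem sum_sqrt_mul_lt_one {x y : A → ℝ} (hx : ∀ a, 0 ≤ x a) (hx1 : ∑ a, x a = 1)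
    (hy : ∀ a, 0 ≤ y a) (hy1 : ∑ a, y a = 1) (hxy : x ≠ y) :
    ∑ a, Real.sqrt (x a * y a) < 1 := by
  obtain ⟨c, hc⟩ := Function.ne_iff.1 hxy
  refine (Finset.sum_lt_sum (fun a _ => sqrt_mul_le_half_add (hx a) (hy a))
    ⟨c, Finset.mem_univ c, sqrt_mul_lt_half_add (hx c) (hy c) hc⟩).trans_eq ?_
  rw [← Finset.sum_div, Finset.sum_add_distrib, hx1, hy1]
  norm_num

theorem affinity_le_one (hg : ∀ u a, 0 ≤ g u a) (hg1 : ∀ u, ∑ a, g u a = 1)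
    (hp : ∀ u a, 0 ≤ p u a) (hp1 : ∀ u, ∑ a, p u a = 1) (k : ℕ) (u : Fin R → A) :
    affinity g p k u ≤ 1 := by
  induction k generalizing u with
  | zero => exact le_rfl
  | succ k ih =>
    refine le_trans (Finset.sum_le_sum fun a _ => ?_)
      (sum_sqrt_mul_le_one (hg u) (hg1 u) (hp u) (hp1 u))
    exact mul_le_of_le_one_right (Real.sqrt_nonneg _) (ih _)

/-- The affinity drops below one as soon as a state in which the kernels differ can be reached. -/
theorem affinity_lt_one (hg : ∀ u a, 0 ≤ g u a) (hg1 : ∀ u, ∑ a, g u a = 1)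
    (hp : ∀ u a, 0 ≤ p u a) (hp1 : ∀ u, ∑ a, p u a = 1) {ω : ℕ → A}
    (hω : ∀ j, 0 < p (block ω j R) (ω (j + R))) {i j k : ℕ} (hik : i < k)
    (hne : g (block ω (j + i) R) ≠ p (block ω (j + i) R)) :
    affinity g p k (block ω j R) < 1 := by
  induction i generalizing j k with
  | zero =>
    obtain ⟨k, rfl⟩ : ∃ l, k = l + 1 := ⟨k - 1, by omega⟩
    refine lt_of_le_of_lt (Finset.sum_le_sum fun a _ => ?_)
      (sum_sqrt_mul_lt_one (hg _) (hg1 (block ω j R)) (hp _) (hp1 _) hne)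
    exact mul_le_of_le_one_right (Real.sqrt_nonneg _) (affinity_le_one hg hg1 hp hp1 _ _)
  | succ i ih =>
    obtain ⟨k, rfl⟩ : ∃ l, k = l + 1 := ⟨k - 1, by omega⟩
    -- If the kernels agree here, the sum is a `p`-average of later affinities, and the transition
    -- along `ω` has positive weight. If they differ, the loss is immediate.
    by_cases hj : g (block ω j R) = p (block ω j R)
    · have h1 := ih (j := j + 1) (k := k) (by omega) (by rwa [show j + 1 + i = j + (i + 1) by omega])
      rw [← hp1 (block ω j R)]
      simp only [affinity, hj, Real.sqrt_mul_self (hp _ _)]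
      refine Finset.sum_lt_sum (fun a _ =>
        mul_le_of_le_one_right (hp _ _) (affinity_le_one hg hg1 hp hp1 _ _))
        ⟨ω (j + R), Finset.mem_univ _, ?_⟩
      rw [next_block]
      exact mul_lt_of_lt_one_right (hω j) h1
    · refine lt_of_le_of_lt (Finset.sum_le_sum fun a _ => ?_)
        (sum_sqrt_mul_lt_one (hg _) (hg1 (block ω j R)) (hp _) (hp1 _) hj)
      exact mul_le_of_le_one_right (Real.sqrt_nonneg _) (affinity_le_one hg hg1 hp hp1 _ _)

/-- A Lyapunov function for the affinity operator. -/
theorem exists_lyapunov {k : ℕ} (hk : 0 < k) {S : Set (Fin R → A)}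
    (hS : ∀ u ∈ S, affinity g p k u < 1) :
    ∃ (l : ℝ) (ψ : (Fin R → A) → ℝ), 0 < l ∧ l < 1 ∧ (∀ u, 1 ≤ ψ u) ∧
      ∀ u ∈ S, ∑ a, Real.sqrt (g u a * p u a) * ψ (next u a) ≤ l * ψ u := by
  have hl : ∃ l : ℝ, 0 < l ∧ l < 1 ∧ ∀ u ∈ S, affinity g p k u ≤ l ^ k := by
    have hlim : Tendsto (fun l : ℝ => l ^ k) (𝓝[<] 1) (𝓝 1) := by
      have : Tendsto (fun l : ℝ => l ^ k) (𝓝 1) (𝓝 (1 ^ k)) := (continuous_pow k).tendsto 1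
      rw [one_pow] at this
      exact this.mono_left nhdsWithin_le_nhds
    have h1 : ∀ᶠ l : ℝ in 𝓝[<] 1, ∀ u : Fin R → A, u ∈ S → affinity g p k u ≤ l ^ k := by
      refine eventually_all.2 fun u => ?_
      by_cases hu : u ∈ S
      · filter_upwards [hlim.eventually (lt_mem_nhds (hS u hu))] with l hl _ using hl.le
      · exact Eventually.of_forall fun l h => absurd h hu
    have h2 : ∀ᶠ l : ℝ in 𝓝[<] 1, l ∈ Set.Ioo (0 : ℝ) 1 :=
      Ioo_mem_nhdsLT one_pos
    obtain ⟨l, hl1, hl2⟩ := (h1.and h2).exists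
    exact ⟨l, hl2.1, hl2.2, hl1⟩
  obtain ⟨l, hl0, hl1, hl⟩ := hl
  -- A truncated resolvent. The affinity operator shifts `j` to `j + 1`, giving `l` times the same
  -- sum with the term `1` at `j = 0` replaced by `l⁻¹ ^ k * affinity g p k u ≤ 1`.
  refine ⟨l, fun u => ∑ j ∈ Finset.range k, l⁻¹ ^ j * affinity g p j u, hl0, hl1, ?_, ?_⟩
  · intro u
    have := Finset.single_le_sum (f := fun j => l⁻¹ ^ j * affinity g p j u)
      (fun j _ => mul_nonneg (by positivity) (affinity_nonneg g p j u)) (Finset.mem_range.2 hk)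
    simpa [affinity] using this
  · intro u hu
    have h1 : ∑ a, Real.sqrt (g u a * p u a) *
          ∑ j ∈ Finset.range k, l⁻¹ ^ j * affinity g p j (next u a) =
        ∑ j ∈ Finset.range k, l⁻¹ ^ j * affinity g p (j + 1) u := by
      simp only [affinity, Finset.mul_sum]
      rw [Finset.sum_comm]
      exact Finset.sum_congr rfl fun j _ => Finset.sum_congr rfl fun a _ => by ring
    have h2 : ∑ j ∈ Finset.range k, l⁻¹ ^ j * affinity g p (j + 1) u =
        l * ∑ j ∈ Finset.range k, l⁻¹ ^ (j + 1) * affinity g p (j + 1) u := by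
      rw [Finset.mul_sum]
      refine Finset.sum_congr rfl fun j _ => ?_
      rw [pow_succ]
      field_simp
    have h3 := Finset.sum_range_succ (fun j => l⁻¹ ^ j * affinity g p j u) k
    rw [Finset.sum_range_succ'] at h3
    have h4 : l⁻¹ ^ k * affinity g p k u ≤ 1 := by
      rw [inv_pow, inv_mul_le_iff₀ (by positivity), mul_one]
      exact hl u hu
    rw [h1, h2]
    refine mul_le_mul_of_nonneg_left ?_ hl0.le
    simp only [pow_zero, one_mul] at h3
    rw [show affinity g p 0 u = 1 from rfl] at h3
    linarith

end Affinity

/-! ### Decay of likelihood ratios -/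

section Decay

theorem IsStationary.measure_block_eq {A : Type*} [Finite A] [MeasurableSpace A]
    [MeasurableSingletonClass A] {P : Measure (ℕ → A)} (hP : IsStationary P) (m : ℕ) {n : ℕ}
    (x : Fin n → A) : P {ω | block ω m n = x} = wordProb P x := by
  have h := hP.iterate m
  have hit : ∀ (m : ℕ) (ω : ℕ → A),
      (fun (ω : ℕ → A) (k : ℕ) => ω (k + 1))^[m] ω = fun k => ω (k + m) := by
    intro m
    induction m with
    | zero => intro ω; rfl
    | succ m ih =>
      intro ω
      rw [Function.iterate_succ_apply, ih]
      funext k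
      exact congrArg ω (by omega)
  have hms : MeasurableSet {ω : ℕ → A | block ω 0 n = x} :=
    (measurableSet_singleton x).preimage (measurable_block 0 n)
  rw [wordProb, ← h.measure_preimage hms.nullMeasurableSet]
  congr 1
  ext ω
  simp only [Set.mem_ofPred_eq, Set.mem_preimage, hit]
  have : block (fun k => ω (k + m)) 0 n = block ω m n := by
    funext i
    simp [block, add_comm]
  rw [this]

theorem IsStationary.ae_wordProb_block_pos {A : Type*} [Finite A] [MeasurableSpace A]
    [MeasurableSingletonClass A] {P : Measure (ℕ → A)} (hP : IsStationary P) (n : ℕ) :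
    ∀ᵐ ω ∂P, ∀ m, 0 < wordProb P (block ω m n) := by
  refine ae_all_iff.2 fun m => ?_
  have h : ∀ᵐ ω ∂P, ∀ x : Fin n → A, wordProb P x = 0 → block ω m n ≠ x := by
    refine ae_all_iff.2 fun x => ?_
    by_cases hx : wordProb P x = 0
    · have : ∀ᵐ ω ∂P, block ω m n ≠ x := by
        rw [ae_iff]
        simpa [hP.measure_block_eq] using hx
      filter_upwards [this] with ω hω _ using hω
    · exact Eventually.of_forall fun ω h => absurd h hx
  filter_upwards [h] with ω hω
  exact pos_iff_ne_zero.2 fun h0 => hω _ h0 rfl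

variable {A : Type*} {R : ℕ}

/-- The square root of the likelihood ratio of `m` letters with respect to the kernels `g`
and `p`. -/
def rootRatio (g : (Fin R → A) → A → ℝ) (p : (Fin R → A) → PMF A) (m : ℕ) (ω : ℕ → A) : ENNReal :=
  ∏ j ∈ Finset.range m, ENNReal.ofReal (Real.sqrt (g (block ω j R) (ω (j + R)) /
    (p (block ω j R) (ω (j + R))).toReal))

theorem rootRatio_congr (g : (Fin R → A) → A → ℝ) (p : (Fin R → A) → PMF A) {m : ℕ}
    {x y : ℕ → A} (h : ∀ i < m + R, x i = y i) : rootRatio g p m x = rootRatio g p m y := by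
  refine Finset.prod_congr rfl fun j hj => ?_
  rw [Finset.mem_range] at hj
  rw [h (j + R) (by omega), block_congr (y := y) fun i hi => h i (by omega)]

variable [Fintype A] [MeasurableSpace A] [MeasurableSingletonClass A]
  {P : Measure (ℕ → A)} {p : (Fin R → A) → PMF A}

/-- Integrating out the last letter turns `p * √(g / p)` into `√(g * p)`, so the Lyapunov inequality
contracts the weighted integral by `l` at each step. By stationarity almost every path visits only
states of positive probability, hence the inequality is needed only there. -/
theorem IsTransition.lintegral_rootRatio_le [Nonempty A] (hp : IsTransition P R p)
    (hst : IsStationary P) {g : (Fin R → A) → A → ℝ} {l : ℝ} (hl : 0 ≤ l)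
    {ψ : (Fin R → A) → ℝ} (hψ : ∀ u, 0 ≤ ψ u)
    (h : ∀ u, 0 < wordProb P u →
      ∑ a, Real.sqrt (g u a * (p u a).toReal) * ψ (next u a) ≤ l * ψ u) (m : ℕ) :
    ∫⁻ ω, rootRatio g p m ω * ENNReal.ofReal (ψ (block ω m R)) ∂P ≤
      ENNReal.ofReal l ^ m * ∫⁻ ω, ENNReal.ofReal (ψ (block ω 0 R)) ∂P := by
  induction m with
  | zero => simp [rootRatio]
  | succ m ih =>
    rw [hp.lintegral_eq (m := m)]
    · calc ∫⁻ ω, ∑ a, p (block ω m R) a *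
            (rootRatio g p (m + 1) (Function.update ω (m + R) a) *
              ENNReal.ofReal (ψ (block (Function.update ω (m + R) a) (m + 1) R))) ∂P
          ≤ ∫⁻ ω, ENNReal.ofReal l *
              (rootRatio g p m ω * ENNReal.ofReal (ψ (block ω m R))) ∂P := by
            refine lintegral_mono_ae ?_
            filter_upwards [hst.ae_wordProb_block_pos R] with ω hω
            set u := block ω m R with hu
            have hterm : ∀ a, p u a * (rootRatio g p (m + 1) (Function.update ω (m + R) a) *
                ENNReal.ofReal (ψ (block (Function.update ω (m + R) a) (m + 1) R))) =
                rootRatio g p m ω *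
                  ENNReal.ofReal (Real.sqrt (g u a * (p u a).toReal) * ψ (next u a)) := by
              intro a
              have h1 : block (Function.update ω (m + R) a) (m + 1) R = next u a := by
                rw [← next_block, block_update le_rfl, Function.update_self]
              have h2 : rootRatio g p (m + 1) (Function.update ω (m + R) a) =
                  rootRatio g p m ω * ENNReal.ofReal (Real.sqrt (g u a / (p u a).toReal)) := by
                rw [rootRatio, Finset.prod_range_succ, block_update le_rfl, Function.update_self]
                congr 1
                exact rootRatio_congr g p fun i hi => Function.update_of_ne hi.ne _ _
              have h3 : (p u a).toReal * Real.sqrt (g u a / (p u a).toReal) =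
                  Real.sqrt (g u a * (p u a).toReal) := by
                rcases (ENNReal.toReal_nonneg (a := p u a)).eq_or_lt with h0 | h0
                · rw [← h0]; simp
                · have h4 : g u a * (p u a).toReal =
                      (p u a).toReal ^ 2 * (g u a / (p u a).toReal) := by field_simp
                  rw [h4, Real.sqrt_mul (sq_nonneg _), Real.sqrt_sq h0.le]
              rw [h1, h2, ENNReal.ofReal_mul (Real.sqrt_nonneg _), ← h3,
                ENNReal.ofReal_mul ENNReal.toReal_nonneg,
                ENNReal.ofReal_toReal ((p u).apply_ne_top a)]
              ring
            simp only [hterm]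
            rw [← Finset.mul_sum, ← ENNReal.ofReal_sum_of_nonneg fun a _ =>
              mul_nonneg (Real.sqrt_nonneg _) (hψ _), mul_left_comm, ← ENNReal.ofReal_mul hl]
            gcongr
            exact h u (hω m)
        _ = ENNReal.ofReal l * ∫⁻ ω, rootRatio g p m ω * ENNReal.ofReal (ψ (block ω m R)) ∂P :=
            lintegral_const_mul' _ _ ENNReal.ofReal_ne_top
        _ ≤ _ := by
            rw [pow_succ', mul_assoc]
            gcongr
    · intro x y hxy
      simp only [Set.mem_Iio] at hxy
      have h1 := rootRatio_congr g p (m := m + 1) (x := x) (y := y) fun i hi => hxy i (by omega)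
      have h2 : block x (m + 1) R = block y (m + 1) R := block_congr fun i hi => hxy i (by omega)
      simp only [h1, h2]

/-- Exponential decay of the likelihood ratio against a kernel of small affinity. -/
theorem IsTransition.ae_rootRatio_le [Nonempty A] [IsProbabilityMeasure P]
    (hp : IsTransition P R p) (hst : IsStationary P) {g : (Fin R → A) → A → ℝ} {k : ℕ}
    (hk : 0 < k)
    (hg : ∀ u, 0 < wordProb P u → affinity g (fun u a => (p u a).toReal) k u < 1) :
    ∃ l : ℝ, 0 < l ∧ l < 1 ∧ ∀ᵐ ω ∂P, ∀ᶠ m in atTop, rootRatio g p m ω ≤ ENNReal.ofReal l ^ m := by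
  obtain ⟨l, ψ, hl0, hl1, hψ, hlψ⟩ :=
    exists_lyapunov hk (S := {u | 0 < wordProb P u}) fun u hu => hg u hu
  have hint := hp.lintegral_rootRatio_le hst hl0.le (fun u => zero_le_one.trans (hψ u)) hlψ
  set c := ∫⁻ ω, ENNReal.ofReal (ψ (block ω 0 R)) ∂P with hc
  have hcfin : c ≠ ⊤ := by
    rw [hc, lintegral_comp_block P fun u => ENNReal.ofReal (ψ u)]
    exact ENNReal.sum_ne_top.2 fun u _ => ENNReal.mul_ne_top ENNReal.ofReal_ne_top
      ((wordProb_le_one P u).trans_lt ENNReal.one_lt_top).ne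
  have hmeas : ∀ m, Measurable (rootRatio g p m) := fun m =>
    measurable_of_dependsOn (n := m + R) fun x y h => rootRatio_congr g p h
  have hbound : ∀ m, ∫⁻ ω, rootRatio g p m ω ∂P ≤ ENNReal.ofReal l ^ m * c := by
    intro m
    refine (lintegral_mono fun ω => ?_).trans (hint m)
    refine le_mul_of_one_le_right zero_le ?_
    rw [← ENNReal.ofReal_one]
    exact ENNReal.ofReal_le_ofReal (hψ _)
  -- Splitting `l = b * b` leaves a spare factor `b ^ m`, which makes the series of `b⁻¹ ^ m *
  -- rootRatio` integrable; its terms therefore tend to zero almost surely.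
  set b := Real.sqrt l with hb
  have hb0 : 0 < b := Real.sqrt_pos.2 hl0
  have hb1 : b < 1 := by rw [hb, Real.sqrt_lt' one_pos]; simpa using hl1
  have hbb : b * b = l := Real.mul_self_sqrt hl0.le
  refine ⟨b, hb0, hb1, ?_⟩
  have hsum : ∫⁻ ω, ∑' m, ENNReal.ofReal (b⁻¹ ^ m) * rootRatio g p m ω ∂P ≠ ⊤ := by
    rw [lintegral_tsum fun m => ((hmeas m).const_mul _).aemeasurable]
    have hle : ∀ m, ∫⁻ ω, ENNReal.ofReal (b⁻¹ ^ m) * rootRatio g p m ω ∂P ≤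
        ENNReal.ofReal b ^ m * c := by
      intro m
      rw [lintegral_const_mul _ (hmeas m)]
      calc ENNReal.ofReal (b⁻¹ ^ m) * ∫⁻ ω, rootRatio g p m ω ∂P
          ≤ ENNReal.ofReal (b⁻¹ ^ m) * (ENNReal.ofReal l ^ m * c) := by gcongr; exact hbound m
        _ = ENNReal.ofReal b ^ m * c := by
          rw [← mul_assoc, ← ENNReal.ofReal_pow hl0.le, ← ENNReal.ofReal_pow hb0.le,
            ← ENNReal.ofReal_mul (by positivity), ← mul_pow, ← hbb, inv_mul_cancel_left₀ hb0.ne']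
    refine ne_top_of_le_ne_top ?_ (ENNReal.tsum_le_tsum hle)
    rw [ENNReal.tsum_mul_right, ENNReal.tsum_geometric]
    refine ENNReal.mul_ne_top (ENNReal.inv_ne_top.2 ?_) hcfin
    rw [Ne, tsub_eq_zero_iff_le, not_le, ← ENNReal.ofReal_one]
    exact (ENNReal.ofReal_lt_ofReal_iff one_pos).2 hb1
  have hfin := ae_lt_top (Measurable.tsum fun m => (hmeas m).const_mul _) hsum
  filter_upwards [hfin] with ω hω
  have hlim := ENNReal.tendsto_atTop_zero_of_tsum_ne_top hω.ne
  filter_upwards [hlim.eventually (gt_mem_nhds one_pos)] with m hm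
  calc rootRatio g p m ω
      = ENNReal.ofReal b ^ m * (ENNReal.ofReal (b⁻¹ ^ m) * rootRatio g p m ω) := by
        rw [← mul_assoc, ← ENNReal.ofReal_pow hb0.le, ← ENNReal.ofReal_mul (by positivity),
          ← mul_pow, mul_inv_cancel₀ hb0.ne', one_pow, ENNReal.ofReal_one, one_mul]
    _ ≤ ENNReal.ofReal b ^ m * 1 := by gcongr
    _ = _ := mul_one _

end Decay

/-! ### Underestimation of the order -/

section Underestimation

variable {A : Type*} [Fintype A] [Nonempty A] [MeasurableSpace A] [MeasurableSingletonClass A]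
  {P : Measure (ℕ → A)} {R r : ℕ} {p : (Fin R → A) → PMF A}

/-- If the transition probabilities depend only on the last `r` letters then the stationary chain
is of order at most `r`. -/
theorem IsTransition.of_eq_suffix (hp : IsTransition P R p) (hst : IsStationary P) (hr : r ≤ R)
    {q : (Fin r → A) → PMF A}
    (h : ∀ u, 0 < wordProb P u → q (MarkovOrder.suffix r hr u) = p u) : IsTransition P r q := by
  classical
  refine isTransition_of_succ fun m x => ?_
  set k := m + r with hk
  -- Stationarity moves the word to start at position `R`, so that a full context of `R` letters
  -- precedes every letter, even when `k < R`.
  let E : Set (ℕ → A) := {ω | block ω R k = block x 0 k}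
  have hE : MeasurableSet E :=
    (measurableSet_singleton (block x 0 k)).preimage (measurable_block R k)
  let E' : Set (ℕ → A) := {ω | block ω R (k + 1) = block x 0 (k + 1)}
  have hE' : MeasurableSet E' :=
    (measurableSet_singleton (block x 0 (k + 1))).preimage (measurable_block R (k + 1))
  have hmem : ∀ ω : ℕ → A, ω ∈ E' ↔ ω ∈ E ∧ ω (k + R) = x k := by
    intro ω
    have h1 : ∀ n, block ω R n = block (fun i => ω (R + i)) 0 n := fun n => by
      funext i; simp [block]
    simp only [E, E', Set.mem_ofPred_eq, h1, block_zero_succ_eq_iff, add_comm k R]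
  have hupd : ∀ (ω : ℕ → A) a, Function.update ω (k + R) a ∈ E' ↔ ω ∈ E ∧ a = x k := by
    intro ω a
    rw [hmem, Function.update_self]
    refine and_congr_left fun _ => ?_
    simp only [E, Set.mem_ofPred_eq]
    rw [block_update (by omega)]
  rw [← hst.measure_block_eq R (block x 0 (k + 1)), ← hst.measure_block_eq R (block x 0 k)]
  change P E' = P E * _
  rw [← lintegral_indicator_one hE', hp.lintegral_eq (m := k), ← lintegral_indicator_one hE,
    ← lintegral_mul_const _ (measurable_one.indicator hE)]
  · refine lintegral_congr_ae ?_
    filter_upwards [hst.ae_wordProb_block_pos R] with ω hω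
    by_cases hωE : ω ∈ E
    · have h2 : MarkovOrder.suffix r hr (block ω k R) = block x m r := by
        rw [suffix_block]
        funext i
        have h3 := congrFun (show block ω R k = block x 0 k from hωE) ⟨m + i, by omega⟩
        simp only [block, zero_add] at h3 ⊢
        rw [← h3]
        congr 1
        omega
      simp [Set.indicator_apply, hupd, hωE, ← h _ (hω k), h2]
    · simp [hupd, hωE]
  · intro y z hyz
    simp only [Set.mem_Iio] at hyz
    have : block y R (k + 1) = block z R (k + 1) := block_congr fun i hi => hyz i (by omega)
    simp only [Set.indicator_apply, E', Set.mem_ofPred_eq, this, Pi.one_apply]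

/-- If `g` agreed with `p` at all states of positive probability, `P` would be of order at most `r`.
So they differ at some such state, and irreducibility reaches it from every `u`. There are finitely
many pairs of states, so one horizon `k` serves all `g` and `u`. -/
theorem IsTransition.exists_affinity_lt_one (hp : IsTransition P R p) (hst : IsStationary P)
    [IsProbabilityMeasure P] (hirr : IsIrreducible P R) (hr : r ≤ R) (hnot : P ∉ markovLaws A r) :
    ∃ k, 0 < k ∧ ∀ g : (Fin r → A) → A → ℝ, (∀ b, g b ∈ stdSimplex ℝ A) →
      ∀ u, 0 < wordProb P u →
        affinity (fun u => g (MarkovOrder.suffix r hr u)) (fun u a => (p u a).toReal) k u < 1 := by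
  choose! M hM using hirr
  refine ⟨(Finset.univ.sup fun x : (Fin R → A) × (Fin R → A) => M x.1 x.2) + 1, by omega, ?_⟩
  intro g hg u hu
  obtain ⟨v, hv, hne⟩ : ∃ v, 0 < wordProb P v ∧
      g (MarkovOrder.suffix r hr v) ≠ fun a => (p v a).toReal := by
    by_contra! hall
    have hsum : ∀ b, ∑ a, ENNReal.ofReal (g b a) = 1 := fun b => by
      rw [← ENNReal.ofReal_sum_of_nonneg fun a _ => (hg b).1 a, (hg b).2, ENNReal.ofReal_one]
    have htr : IsTransition P r fun b =>
        PMF.ofFintype (fun a => ENNReal.ofReal (g b a)) (hsum b) := by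
      refine hp.of_eq_suffix hst hr fun v hv => ?_
      ext a
      rw [PMF.ofFintype_apply, hall v hv, ENNReal.ofReal_toReal ((p v).apply_ne_top a)]
    exact hnot ⟨inferInstance, (⟨_, htr⟩ : ∃ q, IsTransition P r q)⟩
  obtain ⟨ω, ⟨hω0, hωm⟩, hω⟩ := Measure.exists_mem_of_measure_ne_zero_of_ae (hM u v hu hv).ne'
    (ae_restrict_of_ae (ae_wordProb_pos P))
  rw [← hω0]
  refine affinity_lt_one (fun u a => (hg (MarkovOrder.suffix r hr u)).1 a)
    (fun u => (hg (MarkovOrder.suffix r hr u)).2)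
    (fun u a => ENNReal.toReal_nonneg) (fun u => PMF.sum_toReal _)
    (fun j => ENNReal.toReal_pos (hp.pos_of_wordProb_pos hω j).ne' ((p _).apply_ne_top _))
    (i := M u v) (j := 0) ?_ ?_
  · exact Nat.lt_succ_of_le (Finset.le_sup (f := fun x : (Fin R → A) × (Fin R → A) => M x.1 x.2)
      (Finset.mem_univ (u, v)))
  · rw [zero_add, hωm]
    exact hne

/-- Finitely many upper brackets, of small affinity, for the kernels of order `r`. -/
theorem IsTransition.exists_brackets (hp : IsTransition P R p) (hst : IsStationary P)
    [IsProbabilityMeasure P] (hirr : IsIrreducible P R) (hr : r ≤ R) (hnot : P ∉ markovLaws A r) :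
    ∃ k, 0 < k ∧ ∃ G : Finset ((Fin r → A) → A → ℝ),
      (∀ g ∈ G, (∀ b a, 0 ≤ g b a) ∧ ∀ u, 0 < wordProb P u →
        affinity (fun u => g (MarkovOrder.suffix r hr u)) (fun u a => (p u a).toReal) k u < 1) ∧
      ∀ q : (Fin r → A) → A → ℝ, (∀ b, q b ∈ stdSimplex ℝ A) → ∃ g ∈ G, ∀ b a, q b a ≤ g b a := by
  classical
  obtain ⟨k, hk, haff⟩ := hp.exists_affinity_lt_one hst hirr hr hnot
  refine ⟨k, hk, ?_⟩
  let K : Set ((Fin r → A) → A → ℝ) := Set.univ.pi fun _ => stdSimplex ℝ A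
  have hK : IsCompact K := isCompact_univ_pi fun _ => isCompact_stdSimplex ℝ A
  -- By continuity `g` can be raised to a strict, unnormalized upper bracket while its affinity
  -- stays below 1.
  have hδ : ∀ g ∈ K, ∃ δ : ℝ, 0 < δ ∧ ∀ u, 0 < wordProb P u →
      affinity (fun u a => g (MarkovOrder.suffix r hr u) a + δ)
        (fun u a => (p u a).toReal) k u < 1 := by
    intro g hg
    have h1 : ∀ᶠ δ : ℝ in 𝓝[>] 0, ∀ u, 0 < wordProb P u →
        affinity (fun u a => g (MarkovOrder.suffix r hr u) a + δ)
          (fun u a => (p u a).toReal) k u < 1 := by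
      refine eventually_all.2 fun u => ?_
      by_cases hu : 0 < wordProb P u
      · have hcont := continuous_affinity
          (g := fun (δ : ℝ) (u : Fin R → A) a => g (MarkovOrder.suffix r hr u) a + δ)
          (fun u a => by fun_prop) (fun u a => (p u a).toReal) k u
        have hlim := (hcont.tendsto 0).mono_left (nhdsWithin_le_nhds (s := Set.Ioi 0))
        simp only [add_zero] at hlim
        filter_upwards [hlim.eventually
          (gt_mem_nhds (haff g (fun b => hg b (Set.mem_univ b)) u hu))] with δ hδ _ using hδ
      · exact Eventually.of_forall fun δ h => absurd h hu
    obtain ⟨δ, hδ1, hδ0⟩ := (h1.and self_mem_nhdsWithin).exists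
    exact ⟨δ, hδ0, hδ1⟩
  choose! δ hδ0 hδ1 using hδ
  obtain ⟨t, htK, ht⟩ := hK.elim_nhds_subcover
    (fun g => {y | ∀ b a, y b a < g b a + δ g}) (by
      intro g hg
      have : ∀ᶠ y in 𝓝 g, ∀ b a, y b a < g b a + δ g := by
        refine eventually_all.2 fun b => eventually_all.2 fun a => ?_
        have hc : Continuous fun y : (Fin r → A) → A → ℝ => y b a := by fun_prop
        exact (hc.tendsto g).eventually (gt_mem_nhds (by linarith [hδ0 g hg]))
      exact this)
  refine ⟨t.image fun g b a => g b a + δ g, ?_, ?_⟩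
  · intro g' hg'
    obtain ⟨g, hg, rfl⟩ := Finset.mem_image.1 hg'
    refine ⟨fun b a => ?_, hδ1 g (htK g hg)⟩
    have h1 := (htK g hg b (Set.mem_univ b)).1 a
    have h2 := hδ0 g (htK g hg)
    positivity
  · intro q hq
    obtain ⟨g, hg, hgq⟩ := Set.mem_iUnion₂.1 (ht (show q ∈ K from fun b _ => hq b))
    exact ⟨_, Finset.mem_image_of_mem _ hg, fun b a => (hgq b a).le⟩

/-- The likelihood of every chain of smaller order is exponentially smaller than the
likelihood of the true chain. -/
theorem IsTransition.ae_wordProb_le_exp (hp : IsTransition P R p) (hst : IsStationary P)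
    [IsProbabilityMeasure P] (hirr : IsIrreducible P R) (hr : r ≤ R) (hnot : P ∉ markovLaws A r) :
    ∃ c : ℝ, 0 < c ∧ ∀ᵐ ω ∂P, ∃ D : ℝ, ∀ᶠ n : ℕ in atTop, ∀ Q ∈ markovLaws A r,
      wordProb Q (block ω 0 n) ≤
        ENNReal.ofReal (Real.exp (D - c * n)) * wordProb P (block ω 0 n) := by
  obtain ⟨k, hk, G, hG, hbr⟩ := hp.exists_brackets hst hirr hr hnot
  have hdecay : ∀ g : G, ∃ l : ℝ, 0 < l ∧ l < 1 ∧ ∀ᵐ ω ∂P, ∀ᶠ m in atTop,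
      rootRatio (fun u => g.1 (MarkovOrder.suffix r hr u)) p m ω ≤ ENNReal.ofReal l ^ m :=
    fun g => hp.ae_rootRatio_le hst hk (hG g.1 g.2).2
  choose l hl0 hl1 hl using hdecay
  -- The worst rate over the finitely many brackets; the factor 2 comes from squaring the root
  -- ratio.
  obtain ⟨c, hc, hcle⟩ := exists_pos_forall_le fun g : G => -(2 * Real.log (l g))
  refine ⟨c, hc, ?_⟩
  filter_upwards [ae_all_iff.2 hl, ae_wordProb_pos P] with ω hω hpos
  have htop : wordProb P (block ω 0 R) ≠ ⊤ :=
    ((wordProb_le_one P _).trans_lt ENNReal.one_lt_top).ne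
  have hinit := ENNReal.toReal_pos (hpos R).ne' htop
  set D₀ := Real.log (wordProb P (block ω 0 R)).toReal with hD₀
  have hD₀' : wordProb P (block ω 0 R) = ENNReal.ofReal (Real.exp D₀) := by
    rw [hD₀, Real.exp_log hinit, ENNReal.ofReal_toReal htop]
  -- `c * R` accounts for decay over `n - R` rather than `n` letters, and `D₀` for the initial word
  -- under `P`.
  refine ⟨c * R - D₀, ?_⟩
  have hev := (tendsto_sub_atTop_nat R).eventually (eventually_all.2 hω)
  filter_upwards [hev, eventually_ge_atTop R] with n hn hRn Q hQ
  obtain ⟨m, rfl⟩ := Nat.exists_eq_add_of_le hRn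
  rw [Nat.add_sub_cancel_left] at hn
  obtain ⟨_, q, hq⟩ := hQ
  obtain ⟨g, hg, hgq⟩ := hbr (fun b a => (q b a).toReal)
    fun b => ⟨fun a => ENNReal.toReal_nonneg, PMF.sum_toReal _⟩
  have hQR := IsTransition.suffix (P := Q) (q := q) hq hr m ω
  have hlg : ENNReal.ofReal (l ⟨g, hg⟩) ^ m * ENNReal.ofReal (l ⟨g, hg⟩) ^ m ≤
      ENNReal.ofReal (Real.exp (-(c * m))) := by
    have h1 : c ≤ -(2 * Real.log (l ⟨g, hg⟩)) := hcle ⟨g, hg⟩ (by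
      have := Real.log_neg (hl0 ⟨g, hg⟩) (hl1 ⟨g, hg⟩)
      linarith)
    rw [← mul_pow, ← ENNReal.ofReal_mul (hl0 _).le, ← ENNReal.ofReal_pow (by
      have := hl0 ⟨g, hg⟩; positivity)]
    refine ENNReal.ofReal_le_ofReal ?_
    rw [← Real.log_le_iff_le_exp (by have := hl0 ⟨g, hg⟩; positivity), Real.log_pow,
      Real.log_mul (hl0 _).ne' (hl0 _).ne']
    have h2 : (0 : ℝ) ≤ m := by positivity
    nlinarith
  have hprod : ∏ j ∈ Finset.range m, q (MarkovOrder.suffix r hr (block ω j R)) (ω (j + R)) ≤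
      ENNReal.ofReal (Real.exp (-(c * m))) *
        ∏ j ∈ Finset.range m, p (block ω j R) (ω (j + R)) := by
    calc ∏ j ∈ Finset.range m, q (MarkovOrder.suffix r hr (block ω j R)) (ω (j + R))
        ≤ rootRatio (fun u => g (MarkovOrder.suffix r hr u)) p m ω *
            rootRatio (fun u => g (MarkovOrder.suffix r hr u)) p m ω *
            ∏ j ∈ Finset.range m, p (block ω j R) (ω (j + R)) := by
          rw [rootRatio, ← Finset.prod_mul_distrib, ← Finset.prod_mul_distrib]
          refine Finset.prod_le_prod' fun j _ => ?_
          have hpj := ENNReal.toReal_pos (hp.pos_of_wordProb_pos hpos j).ne' ((p _).apply_ne_top _)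
          have hg0 := (hG g hg).1 (MarkovOrder.suffix r hr (block ω j R)) (ω (j + R))
          rw [← ENNReal.ofReal_mul (Real.sqrt_nonneg _),
            Real.mul_self_sqrt (div_nonneg hg0 hpj.le)]
          conv_rhs => rw [← ENNReal.ofReal_toReal ((p (block ω j R)).apply_ne_top (ω (j + R)))]
          rw [← ENNReal.ofReal_mul (by positivity), ENNReal.toReal_ofReal hpj.le,
            div_mul_cancel₀ _ hpj.ne']
          exact (ENNReal.le_ofReal_iff_toReal_le ((q _).apply_ne_top _) hg0).2 (hgq _ _)
      _ ≤ _ := by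
          refine mul_le_mul_left ((mul_le_mul' (hn ⟨g, hg⟩) (hn ⟨g, hg⟩)).trans hlg) _
  rw [hQR, hp m ω]
  calc wordProb Q (block ω 0 R) *
        ∏ j ∈ Finset.range m, q (MarkovOrder.suffix r hr (block ω j R)) (ω (j + R))
      ≤ 1 * (ENNReal.ofReal (Real.exp (-(c * m))) *
        ∏ j ∈ Finset.range m, p (block ω j R) (ω (j + R))) :=
        mul_le_mul' (wordProb_le_one Q _) hprod
    _ = _ := by
        rw [hD₀', one_mul, ← mul_assoc, ← ENNReal.ofReal_mul (by positivity), ← Real.exp_add]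
        congr 4
        push_cast
        ring

end Underestimation

/-! ### Asymptotics of the penalty -/

section Penalty

theorem tendsto_log_log_natCast :
    Tendsto (fun n : ℕ => Real.log (Real.log n)) atTop atTop :=
  Real.tendsto_log_atTop.comp (Real.tendsto_log_atTop.comp tendsto_natCast_atTop_atTop)

theorem eventually_log_natLog_le :
    ∀ᶠ n : ℕ in atTop,
      Real.log (Nat.log 2 n + 2) ≤ Real.log (Real.log n) + Real.log 4 := by
  have h := (Real.tendsto_log_atTop.comp tendsto_natCast_atTop_atTop).eventually_ge_atTop (2 : ℝ)
  filter_upwards [h] with n hn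
  simp only [Function.comp_apply] at hn
  rw [← Real.log_mul (by positivity) (by norm_num)]
  refine Real.log_le_log (by positivity) ?_
  have h1 : (Nat.log 2 n : ℝ) ≤ Real.logb 2 n := Real.natLog_le_logb n 2
  rw [Real.logb] at h1
  have h2 : Real.log n / Real.log 2 ≤ 2 * Real.log n := by
    rw [div_le_iff₀ (Real.log_pos (by norm_num))]
    nlinarith [Real.log_two_gt_d9]
  linarith

/-- With `X = |A| ^ k ≥ 2 |A| ^ r` and `L = log log n`, the penalty gains at least `25 X L` while
the excess likelihood is at most `16 X L` plus a constant multiple of `X`. Since `k + 1 ≤ X`, the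
threshold on `n` is uniform in `k`; the surplus `25 - 16` is the 9 below. -/
theorem eventually_overestimation_cost_lt (A : Type*) [Fintype A] [Nontrivial A] {f : ℕ → ℝ}
    (hf : ∀ᶠ n in atTop, 50 ≤ f n) (r : ℕ) (δ : ℝ) {D : ℝ} (hD : 0 < D) :
    ∀ᶠ n : ℕ in atTop, ∀ k, r < k →
      (Fintype.card A : ℝ) ^ r * f n * Real.log (Real.log n) +
        (D * (k + 1) + 8 * (Fintype.card A : ℝ) ^ k * mixtureCost A δ n) <
      (Fintype.card A : ℝ) ^ k * f n * Real.log (Real.log n) := by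
  set C := Fintype.card A * Real.log (1 + 2 / δ) with hC
  filter_upwards [hf, eventually_log_natLog_le,
    tendsto_log_log_natCast.eventually_gt_atTop ((2 * D + 8 * |C| + 16 * Real.log 4) / 9),
    tendsto_log_log_natCast.eventually_gt_atTop 0] with n hfn hlog hL hL0 k hk
  set L := Real.log (Real.log n)
  have hcard : (2 : ℝ) ≤ Fintype.card A := by exact_mod_cast Fintype.one_lt_card (α := A)
  set X := (Fintype.card A : ℝ) ^ k with hX
  have hXr : 2 * (Fintype.card A : ℝ) ^ r ≤ X := by
    calc 2 * (Fintype.card A : ℝ) ^ r ≤ Fintype.card A * (Fintype.card A : ℝ) ^ r := by gcongr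
      _ = (Fintype.card A : ℝ) ^ (r + 1) := by ring
      _ ≤ X := pow_le_pow_right₀ (by linarith) hk
  have hkX : (k : ℝ) + 1 ≤ X := by
    have h1 : k + 1 ≤ 2 ^ k := Nat.lt_two_pow_self
    have h2 : ((k + 1 : ℕ) : ℝ) ≤ ((2 ^ k : ℕ) : ℝ) := Nat.cast_le.2 h1
    push_cast at h2
    exact h2.trans (by rw [hX]; gcongr)
  have hX0 : 0 < X := by positivity
  have hcost : mixtureCost A δ n ≤ |C| + 2 * (L + Real.log 4) := by
    rw [mixtureCost, ← hC]
    have := le_abs_self C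
    linarith
  have hfL : 50 * L ≤ f n * L := by gcongr
  rw [div_lt_iff₀ (by norm_num)] at hL
  have h1 : D * (k + 1) ≤ D * X := by gcongr
  have h2 : 8 * X * mixtureCost A δ n ≤ 8 * X * (|C| + 2 * (L + Real.log 4)) := by gcongr
  have h3 : (Fintype.card A : ℝ) ^ r * (f n * L) ≤ X / 2 * (f n * L) := by
    gcongr
    linarith
  have h4 : X / 2 * (50 * L) ≤ X / 2 * (f n * L) := by gcongr
  have h5 : X * (2 * D + 8 * |C| + 16 * Real.log 4) < X * (L * 9) := by gcongr
  have h6 : 0 < D * X := by positivity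
  linarith

/-- The penalty of the true order and the constant `D` are each eventually below `c n / 2`. -/
theorem eventually_underestimation_gain_lt {a : ℝ} (ha : 1 ≤ a) {f : ℕ → ℝ}
    (hf : ∀ᶠ n in atTop, 50 ≤ f n)
    (hf0 : Tendsto (fun n : ℕ => f n * Real.log (Real.log n) / n) atTop (𝓝 0)) (r k : ℕ) (D : ℝ)
    {c : ℝ} (hc : 0 < c) :
    ∀ᶠ n : ℕ in atTop,
      a ^ r * f n * Real.log (Real.log n) + (D - c * n) <
        a ^ k * f n * Real.log (Real.log n) := by
  have h1 : ∀ᶠ n : ℕ in atTop, f n * Real.log (Real.log n) / n < c / 2 / a ^ r :=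
    hf0.eventually (gt_mem_nhds (by positivity))
  have h2 : ∀ᶠ n : ℕ in atTop, 2 * |D| / c < n :=
    tendsto_natCast_atTop_atTop.eventually_gt_atTop _
  filter_upwards [hf, h1, h2, tendsto_log_log_natCast.eventually_gt_atTop 0,
    eventually_gt_atTop 0] with n hfn hn1 hn2 hL hn
  have hn' : (0 : ℝ) < n := by exact_mod_cast hn
  rw [div_lt_div_iff₀ hn' (by positivity)] at hn1
  rw [div_lt_iff₀ hc] at hn2
  have h3 : 0 ≤ a ^ k * f n * Real.log (Real.log n) := by positivity
  have h4 := le_abs_self D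
  linarith

end Penalty

/-- Strong consistency, for penalty factors eventually at least `50` and cutoffs `log n`. -/
theorem HasOrder.isStronglyConsistent {A : Type*} [Fintype A] [Nontrivial A] [MeasurableSpace A]
    [MeasurableSingletonClass A] {P : Measure (ℕ → A)} {r : ℕ} (hord : HasOrder P r)
    (hst : IsStationary P) (hirr : IsIrreducible P r) {pen : ℕ → ℕ → ℝ} {κ f : ℕ → ℝ}
    {rhat : (n : ℕ) → (Fin n → A) → ℕ}
    (hpen : ∀ᶠ n : ℕ in atTop, ∀ k : ℕ,
      pen n k = (Fintype.card A : ℝ) ^ k * f n * Real.log (Real.log n))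
    (hκ : ∀ᶠ n : ℕ in atTop, κ n ≤ Real.log n) (hκtop : Tendsto κ atTop atTop)
    (hf : ∀ᶠ n in atTop, 50 ≤ f n)
    (hf0 : Tendsto (fun n : ℕ => f n * Real.log (Real.log n) / n) atTop (𝓝 0))
    (hest : IsPenalizedLikelihoodEstimator pen κ rhat) : IsStronglyConsistent P r rhat := by
  obtain ⟨hP, hmin⟩ := hord
  have : IsProbabilityMeasure P := hP.1
  obtain ⟨q, hq⟩ : ∃ q, IsTransition P r q := hP.2
  have hcard : (1 : ℝ) ≤ Fintype.card A := by exact_mod_cast Fintype.card_pos (α := A)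
  obtain ⟨δ, _, hover⟩ := hq.ae_exists_wordProb_le
  have hunder : ∀ᵐ ω ∂P, ∀ k : Fin r, ∀ᶠ n : ℕ in atTop, rhat n (block ω 0 n) ≠ k := by
    refine ae_all_iff.2 fun k => ?_
    obtain ⟨c, hc, hdec⟩ := hq.ae_wordProb_le_exp hst hirr k.2.le
      fun hk => (hmin hk).not_gt k.2
    filter_upwards [hdec, ae_wordProb_pos P] with ω hω hpos
    obtain ⟨D, hD⟩ := hω
    filter_upwards [hD, hpen, hκtop.eventually_gt_atTop (r : ℝ),
      eventually_underestimation_gain_lt hcard hf hf0 r k D hc] with n hn hpn hκn hlt heq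
    have := hest.pen_le hP hκn (hpos n) (B := D - c * n) (by rw [heq]; exact hn)
    rw [heq, hpn, hpn] at this
    linarith
  filter_upwards [hover, hunder, ae_wordProb_pos P] with ω hov hun hpos
  obtain ⟨D, hD, hov⟩ := hov
  refine tendsto_const_nhds.congr' ?_
  filter_upwards [eventually_all.2 hun, hpen, hκ, hκtop.eventually_gt_atTop (r : ℝ),
    eventually_overestimation_cost_lt A hf r δ hD] with n hn hpn hκn hrκ hlt
  set k := rhat n (block ω 0 n) with hk
  rcases lt_trichotomy k r with h | h | h
  · exact absurd rfl (hn ⟨k, h⟩)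
  · exact h.symm
  · have hkκ : (k : ℝ) < κ n := (hest n _ ((Nat.cast_nonneg r).trans_lt hrκ)).1
    -- The logarithmic cutoff enters only here: the bound on likelihood ratios is already uniform
    -- over orders up to `n`.
    have hkn : k ≤ n := by
      have h1 : Real.log n ≤ n := Real.log_le_self n.cast_nonneg
      exact_mod_cast (hkκ.le.trans hκn).trans h1
    have h2 := hest.pen_le hP hrκ (hpos n) (hov n k h.le hkn)
    rw [← hk, hpn, hpn] at h2
    exact absurd (hlt k h) (not_lt.2 h2)

end MarkovOrder

end

theorem corollary1 :
    ∃ Cstar : ℝ, 0 < Cstar ∧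
      ∀ (A : Type*) [Fintype A] [Nontrivial A] [MeasurableSpace A] [MeasurableSingletonClass A]
        (Pstar : Measure (ℕ → A)) (rstar : ℕ),
        MarkovOrder.HasOrder Pstar rstar →
        MarkovOrder.IsStationary Pstar →
        MarkovOrder.IsIrreducible Pstar rstar →
        ∃ αstar : ℝ, 0 < αstar ∧
          ∀ (pen : ℕ → ℕ → ℝ) (κ f : ℕ → ℝ) (rhat : (n : ℕ) → (Fin n → A) → ℕ),
            (∀ᶠ n : ℕ in atTop, ∀ r : ℕ,
              pen n r = (Fintype.card A : ℝ) ^ r * f n * Real.log (Real.log n)) →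
            (∀ᶠ n : ℕ in atTop, κ n ≤ αstar * Real.log n) →
            MonotoneOn κ (Set.Ici 1) →
            Tendsto κ atTop atTop →
            (Cstar : EReal) ≤ liminf (fun n : ℕ => (f n : EReal)) atTop →
            Tendsto (fun n : ℕ => f n * Real.log (Real.log n) / n) atTop (𝓝 0) →
            MarkovOrder.IsPenalizedLikelihoodEstimator pen κ rhat →
            MarkovOrder.IsStronglyConsistent Pstar rstar rhat := by
  -- Any constant above 50 would do: a lower bound on the liminf controls `f` eventually only below
  -- that bound. The cutoff factor 1 works for every chain.
  refine ⟨100, by norm_num, fun A _ _ _ _ P r hord hst hirr => ⟨1, one_pos, ?_⟩⟩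
  intro pen κ f rhat hpen hκ _ hκtop hf hf0 hest
  refine hord.isStronglyConsistent hst hirr hpen (by simpa using hκ) hκtop ?_ hf0 hest
  have hlt : ((50 : ℝ) : EReal) < liminf (fun n : ℕ => (f n : EReal)) atTop :=
    lt_of_lt_of_le (EReal.coe_lt_coe_iff.2 (by norm_num)) hf
  filter_upwards [eventually_lt_of_lt_liminf hlt] with n hn
  exact (EReal.coe_lt_coe_iff.1 hn).le
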